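/- **Setting.** Let $n\ge 2$, $d\ge 1$, $A\in\mathbb{R}_{\ge 0}^{n\times d}$ with rows $A_i$ and largest entry $A_{\max}$, and consider the covering LP $\min 1^\top x$ s.t. $Ax\ge 1$, $x\ge 0$. Two LPs (with the same $n,d$) are neighbors if their matrices differ in at most one row. A randomized algorithm $\mathcal A$ is $(\epsilon,\delta)$-DP if $\Pr[\mathcal A(A)\in O]\le e^{\epsilon}\Pr[\mathcal A(A')\in O]+\delta$ for all neighboring inputs $A,A'$ and all sets $O$. For $U>0$ let $\mathcal D^U=\{r\in\mathbb{R}_{\ge0}^n:\sum_i r_i=1,\ \max_i r_i\le U\}$ and $\mathrm{smin}^U(z)=\min_{r\in\mathcal D^U}\langle z,r\rangle+\sum_i r_i\ln r_i$ (with gradient taken to be $0$ if $\mathcal D^U=\emptyset$). The exponential mechanism with privacy parameter $\epsilon'$ for a score $Q$ of sensitivity $\Delta$ outputs $j$ with probability proportional to $\exp(\epsilon' Q(j)/(2\Delta))$. **Algorithm.** The public parameters are: whether pre-processing is done, numbers $\mathrm{OPT}>0$ and $R$, $\alpha,\beta\in(0,1)$, $\epsilon>0$, $\delta\in(0,1)$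 with $\epsilon\le(8-4\sqrt2)\ln\frac1\delta$. Let $H=\frac{40d}{\alpha\,\mathrm{OPT}}$ with pre-processing and $H=R$ without. With pre-processing, replace each $A_{ij}$ by $\min\{A_{ij},H\}$; without it, the inputs are the matrices with all entries at most $R$. Put $$T=\left\lceil\frac{20H\,\mathrm{OPT}\ln n}{\alpha^2}\right\rceil,\quad \epsilon'=\frac{\epsilon}{2\sqrt{T\ln\frac1\delta}},\quad s_0=\frac{120H\,\mathrm{OPT}\,(\ln d+\ln\frac T\beta)}{\alpha\epsilon'},\quad U=\frac1{s_0},\quad \eta=\frac{\alpha}{10H\,\mathrm{OPT}}.$$ Start from $x_0=0$. For $t=0,\dots,T-1$, choose $j\in[d]$ by the exponential mechanism with privacy parameter $\epsilon'$, score $Q(j)=\langle\nabla\mathrm{smin}^U(\eta Ax_t),A1_j\rangle\,\mathrm{OPT}$ and sensitivity $\Delta=3H\,\mathrm{OPT}/s_0$, and set $x_{t+1}=x_t+\mathrm{OPT}\cdot 1_j$. Output $\overline x=x_T/T$. **Theorem.** For all such parameters (and both with and without pre-processing) the algorithm is $(\epsilon,\delta)$-DP. If moreover $\mathrm{OPT}$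 is the optimal value of the LP given by the input $A$, then the output $x$ always satisfies $x\ge0$ and $1^\top x\le(1+\alpha)\mathrm{OPT}$. Finally, for all constants $K,E$ there is a constant $C>0$ depending only on $K$ and $E$ such that, if $\epsilon\le E$ and $\mathrm{OPT}$ is the optimal value for $A$, then with probability at least $1-\beta$, $A_ix\ge1-\alpha$ (for the original matrix $A$) holds for all $i\in[n]$ except for at most $s$ constraints, where 1. without pre-processing, if $R\le K A_{\max}$: $$s=C\,\frac{(A_{\max}\mathrm{OPT})^{1.5}\,L\,\sqrt{\ln n\,\ln\frac1\delta}}{\alpha^2\epsilon};$$ 2. with pre-processing: $$s=C\,\frac{d^{1.5}\,L\,\sqrt{\ln n\,\ln\frac1\delta}}{\alpha^{3.5}\epsilon};$$ here $L=\min\left\{\ln d+\ln\frac{n}{\alpha\beta},\ \ln d\cdot\ln\frac{n}{\alpha\beta}\right\}$. -/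

import Mathlib

open scoped Matrix

noncomputable section

namespace PrivateCovering

/-! ### Covering linear programs and constraint privacy -/

/-- The feasible points of `min 1ᵀx` subject to `A x ≥ 1`, `x ≥ 0`. -/
def feasible {n d : ℕ} (A : Matrix (Fin n) (Fin d) ℝ) : Set (Fin d → ℝ) :=
  {x | (∀ j, 0 ≤ x j) ∧ ∀ i, 1 ≤ (A *ᵥ x) i}

/-- `opt` is the (attained) optimal value of the covering LP with constraint matrix `A`. -/
def IsOptimalValue {n d : ℕ} (A : Matrix (Fin n) (Fin d) ℝ) (opt : ℝ) : Prop :=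
  IsLeast ((fun x : Fin d → ℝ => ∑ j, x j) '' feasible A) opt

/-- The largest entry of `A`. -/
def maxEntry {n d : ℕ} (A : Matrix (Fin n) (Fin d) ℝ) : ℝ :=
  ⨆ p : Fin n × Fin d, A p.1 p.2

/-- The number of constraints with `A_i x < 1 - α`. -/
def numViolated {n d : ℕ} (A : Matrix (Fin n) (Fin d) ℝ) (α : ℝ) (x : Fin d → ℝ) : ℕ :=
  Set.ncard {i : Fin n | (A *ᵥ x) i < 1 - α}

/-- Two LPs are neighbors if their constraint matrices differ in at most one row. -/
def Neighbors {n d : ℕ} (A A' : Matrix (Fin n) (Fin d) ℝ) : Prop :=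
  ∃ i, ∀ k, k ≠ i → A k = A' k

/-- `(ε, δ)`-differential privacy of a randomized algorithm `M` on the inputs in `dom`. -/
def IsDP {D Ω : Type*} (dom : Set D) (nbr : D → D → Prop) (M : D → PMF Ω) (ε δ : ℝ) : Prop :=
  ∀ a ∈ dom, ∀ a' ∈ dom, nbr a a' → ∀ O : Set Ω,
    (M a).toOuterMeasure O
      ≤ ENNReal.ofReal (Real.exp ε) * (M a').toOuterMeasure O + ENNReal.ofReal δ

/-! ### Exponential mechanism -/

/-- The exponential mechanism with privacy parameter `ε` for a score function `Q` of sensitivity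
`Δ`: it outputs `j` with probability proportional to `exp (ε Q(j) / (2Δ))`. -/
def expMechanism {S : Type*} [Fintype S] [Nonempty S] (ε Δ : ℝ) (Q : S → ℝ) : PMF S :=
  PMF.normalize (fun j => ENNReal.ofReal (Real.exp (ε * Q j / (2 * Δ))))
    (by
      intro h
      obtain ⟨j⟩ := (inferInstance : Nonempty S)
      have hj := ENNReal.tsum_eq_zero.1 h j
      exact absurd (ENNReal.ofReal_eq_zero.1 hj) (not_le.2 (Real.exp_pos _)))
    (by
      rw [tsum_fintype]
      exact ENNReal.sum_ne_top.2 fun _ _ => ENNReal.ofReal_ne_top)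

/-! ### Truncated softmin -/

/-- The unit simplex with coordinates truncated at `U`. -/
def truncSimplex (n : ℕ) (U : ℝ) : Set (Fin n → ℝ) :=
  {r | (∀ i, 0 ≤ r i) ∧ ∑ i, r i = 1 ∧ ∀ i, r i ≤ U}

/-- The negative entropy. -/
def negEntropy {n : ℕ} (r : Fin n → ℝ) : ℝ := ∑ i, r i * Real.log (r i)

/-- The truncated softmin `min_{r ∈ D^U} ⟨x, r⟩ + ω(r)`.  If `D^U` is empty (that is, `n U < 1`)
this is the constant `0`. -/
def smin {n : ℕ} (U : ℝ) (x : Fin n → ℝ) : ℝ :=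
  sInf ((fun r : Fin n → ℝ => x ⬝ᵥ r + negEntropy r) '' truncSimplex n U)

/-- The gradient of the truncated softmin. -/
def gradSmin {n : ℕ} (U : ℝ) (x : Fin n → ℝ) : Fin n → ℝ :=
  fun i => fderiv ℝ (smin (n := n) U) x (Pi.single i 1)

/-! ### The algorithm -/

/-- The public parameters of the algorithm: whether the pre-processing step is executed, the
upper bound `R` for the entries of the matrix (used only without pre-processing), the value `opt`,
the accuracy `α`, the failure probability `β`, and the privacy parameters `ε`, `δ`. -/
structure Params where
  clip : Bool
  R : ℝ
  opt : ℝ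
  α : ℝ
  β : ℝ
  ε : ℝ
  δ : ℝ

namespace Params

/-- The ranges of the parameters.  The last condition says that
`ε / √2 + ε² / (8 log (1/δ)) ≤ ε`. -/
structure Valid (P : Params) : Prop where
  opt_pos : 0 < P.opt
  α_mem : P.α ∈ Set.Ioo (0 : ℝ) 1
  β_mem : P.β ∈ Set.Ioo (0 : ℝ) 1
  ε_pos : 0 < P.ε
  δ_mem : P.δ ∈ Set.Ioo (0 : ℝ) 1
  ε_le : P.ε ≤ (8 - 4 * Real.sqrt 2) * Real.log (1 / P.δ)

/-- The admissible input matrices: nonnegative entries, bounded by `R` if there is no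
pre-processing. -/
def inputs (P : Params) (n d : ℕ) : Set (Matrix (Fin n) (Fin d) ℝ) :=
  {A | (∀ i j, 0 ≤ A i j) ∧ (P.clip = false → ∀ i j, A i j ≤ P.R)}

variable (P : Params) (n d : ℕ)

/-- The bound `H` on the entries of the (pre-processed) matrix. -/
def H : ℝ := if P.clip then 40 * d / (P.α * P.opt) else P.R

/-- The number of iterations. -/
def T : ℕ := ⌈20 * P.H d * P.opt * Real.log n / P.α ^ 2⌉₊

/-- The privacy parameter of each iteration. -/
def ε' : ℝ := P.ε / (2 * Real.sqrt (P.T n d * Real.log (1 / P.δ)))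

/-- The reciprocal of the truncation level. -/
def s : ℝ :=
  120 * P.H d * P.opt * (Real.log d + Real.log (P.T n d / P.β)) / (P.α * P.ε' n d)

/-- The truncation level. -/
def U : ℝ := 1 / P.s n d

/-- The step size. -/
def η : ℝ := P.α / (10 * P.H d * P.opt)

/-- The sensitivity of the score function. -/
def Δ : ℝ := 3 * P.H d * P.opt / P.s n d

variable {n d}

/-- The (optional) pre-processing step. -/
def preprocess (A : Matrix (Fin n) (Fin d) ℝ) : Matrix (Fin n) (Fin d) ℝ :=
  if P.clip then A.map (fun a => min a (P.H d)) else A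

/-- The score `⟨∇smin^U(η A x), A 1_j⟩ opt` of the coordinate `j`. -/
def score (A : Matrix (Fin n) (Fin d) ℝ) (x : Fin d → ℝ) (j : Fin d) : ℝ :=
  (gradSmin (P.U n d) (P.η d • (A *ᵥ x)) ⬝ᵥ (A *ᵥ Pi.single j 1)) * P.opt

/-- The law of the coordinate chosen by the covering oracle at `x`. -/
def oracle [NeZero d] (A : Matrix (Fin n) (Fin d) ℝ) (x : Fin d → ℝ) : PMF (Fin d) :=
  expMechanism (P.ε' n d) (P.Δ n d) (P.score A x)

/-- The law of the iterate `x_t`, for an already pre-processed matrix `A`. -/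
def iterate [NeZero d] (A : Matrix (Fin n) (Fin d) ℝ) : ℕ → PMF (Fin d → ℝ)
  | 0 => PMF.pure 0
  | t + 1 => (iterate A t).bind fun x =>
      (P.oracle A x).map fun j => x + Pi.single j P.opt

/-- The law of the output `x_T / T` of the algorithm on the input matrix `A`. -/
def algorithm [NeZero d] (A : Matrix (Fin n) (Fin d) ℝ) : PMF (Fin d → ℝ) :=
  (P.iterate (P.preprocess A) (P.T n d)).map fun x => (P.T n d : ℝ)⁻¹ • x

/-- With probability at least `1 - β`, the output on input `A` violates at most `b` of the
constraints `A_i x ≥ 1 - α`. -/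
def ViolatesAtMost [NeZero d] (A : Matrix (Fin n) (Fin d) ℝ) (b : ℝ) : Prop :=
  ENNReal.ofReal (1 - P.β)
    ≤ (P.algorithm A).toOuterMeasure {x | (numViolated A P.α x : ℝ) ≤ b}

end Params

end PrivateCovering

end

namespace PrivateCovering

/-! ### Truncated Gibbs distributions and the gradient of the truncated softmin -/

/-! The algorithm is a multiplicative-weights method with the softmin of the constraint values as
its potential. Its gradient is explicit: the minimizer over `D^U` is the Gibbs distribution `c
e^{-z_i}` capped at `U`, with `c` normalizing the mass (`gradSmin_eq`). One duality inequality,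
`truncGibbs_lower_bound`, yields this formula, the differentiability and the smoothness of the
potential.

Privacy. Changing row `k` moves the capped Gibbs weights of all other rows in one direction, and the
total mass moved is at most `U`. Since each entry is at most `H`, every score changes by at most `2
H U OPT`, which is below `Δ` (`abs_score_sub_le`). Each oracle call is therefore purely
`ε'`-private, and so has Rényi divergence of order `a` at most `a ε'^2 / 2` (`sum_mul_rpow_le`). In
the dual form `HolderDominated`, adaptive composition only multiplies constants
(`HolderDominated.bind`); a good choice of `a` turns the bound for `T` steps into `(ε, δ)`-privacy
(`isDP_algorithm`).

Accuracy. Averaging the scores against a nearly optimal solution shows that some score is at least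
`1 - α/40` (`exists_score_ge`), and the exponential mechanism loses at most another `α/20`, except
with probability `β/T`. Each successful step raises the potential by at least `η (1 - α/8)`
(`smin_step`), starting from at least `-ln n`. If at least `1/U = s_0` constraints were violated,
the uniform distribution on them would be admissible and would make the final potential too small
(`numViolated_le_of_smin_ge`). This gives at most `s_0` violations with probability `1 - β`
(`violatesAtMost_s`); the rest is an estimate of `s_0`. The objective bound holds because each step
adds exactly `OPT` to the coordinate sum. -/

/-- The vector with coordinates `min U (c e^{-z_i})`. -/
noncomputable def truncGibbs {n : ℕ} (U c : ℝ) (z : Fin n → ℝ) : Fin n → ℝ :=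
  fun i => min U (c * Real.exp (-z i))

section Gibbs

variable {n : ℕ} {U c : ℝ} {z : Fin n → ℝ}

lemma truncGibbs_pos (hU : 0 < U) (hc : 0 < c) (i : Fin n) : 0 < truncGibbs U c z i :=
  lt_min hU (mul_pos hc (Real.exp_pos _))

lemma truncGibbs_mem (hU : 0 < U) (hc : 0 < c) (h : ∑ i, truncGibbs U c z i = 1) :
    truncGibbs U c z ∈ truncSimplex n U :=
  ⟨fun i => (truncGibbs_pos hU hc i).le, h, fun _ => min_le_left _ _⟩

/-- Intermediate value theorem in `c`: the mass is `0` at `c = 0`, and once `c` is large enough that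
every coordinate is capped it is `n U ≥ 1`. -/
lemma exists_sum_truncGibbs_eq_one (hU : 0 < U) (hn : 1 ≤ n * U) (z : Fin n → ℝ) :
    ∃ c, 0 < c ∧ ∑ i, truncGibbs U c z i = 1 := by
  set g : ℝ → ℝ := fun c => ∑ i, truncGibbs U c z i with hg
  have hcont : Continuous g := by
    simp only [hg, truncGibbs]
    fun_prop
  have h0 : g 0 = 0 := by simp [hg, truncGibbs, hU.le]
  set b : ℝ := ∑ i, U * Real.exp (z i) with hb
  have hb0 : 0 ≤ b := Finset.sum_nonneg fun i _ => by positivity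
  have h1 : g b = n * U := by
    have : ∀ i, truncGibbs U b z i = U := by
      intro i
      refine min_eq_left ?_
      have h2 : U * Real.exp (z i) ≤ b :=
        Finset.single_le_sum (f := fun i => U * Real.exp (z i))
          (fun j _ => by positivity) (Finset.mem_univ i)
      calc U = U * Real.exp (z i) * Real.exp (-z i) := by
            rw [mul_assoc, ← Real.exp_add]; simp
        _ ≤ b * Real.exp (-z i) := by gcongr
    simp [hg, this]
  obtain ⟨c, hc, hc1⟩ := intermediate_value_Icc hb0 hcont.continuousOn
    (show (1 : ℝ) ∈ Set.Icc (g 0) (g b) from ⟨by rw [h0]; norm_num, by rw [h1]; exact hn⟩)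
  refine ⟨c, lt_of_le_of_ne hc.1 ?_, hc1⟩
  rintro rfl
  rw [h0] at hc1
  norm_num at hc1

/-- Weak duality: a truncated Gibbs distribution bounds the perturbed softmin objective. -/
lemma truncGibbs_lower_bound (hU : 0 < U) (hc : 0 < c) (h : ∑ i, truncGibbs U c z i = 1)
    {q : Fin n → ℝ} (hq : q ∈ truncSimplex n U) (v : Fin n → ℝ) :
    z ⬝ᵥ truncGibbs U c z + negEntropy (truncGibbs U c z)
        + ∑ i, truncGibbs U c z i * (1 - Real.exp (-v i))
      ≤ (z + v) ⬝ᵥ q + negEntropy q := by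
  set r := truncGibbs U c z with hr
  -- The Lagrangian inequality coordinate by coordinate: `1 + log c` is the multiplier of the
  -- constraint `∑ r_i = 1`, so its term disappears on summing.
  have key : ∀ i, z i * r i + r i * Real.log (r i) + r i * (1 - Real.exp (-v i))
      + (1 + Real.log c) * (q i - r i) ≤ (z i + v i) * q i + q i * Real.log (q i) := by
    intro i
    have hri : 0 < r i := truncGibbs_pos hU hc i
    have hq0 := hq.1 i
    have hqU := hq.2.2 i
    -- Complementary slackness for the cap: either the cap is active and `q i ≤ U = r i`, or the
    -- first factor vanishes.
    have h1 : 0 ≤ (Real.log c - z i - Real.log (r i)) * (r i - q i) := by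
      rcases le_total U (c * Real.exp (-z i)) with hle | hle
      · have : r i = U := min_eq_left hle
        refine mul_nonneg ?_ (by linarith)
        have h2 : Real.log (r i) ≤ Real.log (c * Real.exp (-z i)) :=
          Real.log_le_log hri (min_le_right _ _)
        rw [Real.log_mul hc.ne' (Real.exp_pos _).ne', Real.log_exp] at h2
        linarith
      · have : r i = c * Real.exp (-z i) := min_eq_right hle
        have h2 : Real.log (r i) = Real.log c - z i := by
          rw [this, Real.log_mul hc.ne' (Real.exp_pos _).ne', Real.log_exp]; ring
        rw [h2]; simp
    -- Fenchel–Young for the entropy; the case `q i = 0` is separate because of the logarithm.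
    have h3 : q i - r i * Real.exp (-v i) ≤
        q i * Real.log (q i) - q i * Real.log (r i) + v i * q i := by
      rcases hq0.eq_or_lt with h0 | h0
      · rw [← h0]; simp; positivity
      · have hw : 0 < r i * Real.exp (-v i) / q i := by positivity
        have h4 := Real.log_le_sub_one_of_pos hw
        rw [Real.log_div (by positivity) h0.ne', Real.log_mul hri.ne' (Real.exp_pos _).ne',
          Real.log_exp] at h4
        have h5 := mul_le_mul_of_nonneg_left h4 h0.le
        have h6 : q i * (r i * Real.exp (-v i) / q i - 1) = r i * Real.exp (-v i) - q i := by
          field_simp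
        rw [h6] at h5
        linarith
    linarith
  have hsum := Finset.sum_le_sum fun i (_ : i ∈ Finset.univ) => key i
  have e1 : ∑ i, (1 + Real.log c) * (q i - r i) = 0 := by
    rw [← Finset.mul_sum, Finset.sum_sub_distrib, h, hq.2.1]; simp
  simp only [Finset.sum_add_distrib] at hsum
  rw [e1] at hsum
  simp only [dotProduct, negEntropy, Pi.add_apply]
  linarith

lemma bddBelow_objective (hU : 0 < U) (hc : 0 < c) (h : ∑ i, truncGibbs U c z i = 1)
    (v : Fin n → ℝ) :
    BddBelow ((fun r : Fin n → ℝ => (z + v) ⬝ᵥ r + negEntropy r) '' truncSimplex n U) := by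
  refine ⟨z ⬝ᵥ truncGibbs U c z + negEntropy (truncGibbs U c z)
        + ∑ i, truncGibbs U c z i * (1 - Real.exp (-v i)), ?_⟩
  rintro _ ⟨q, hq, rfl⟩
  exact truncGibbs_lower_bound hU hc h hq v

lemma smin_eq (hU : 0 < U) (hc : 0 < c) (h : ∑ i, truncGibbs U c z i = 1) :
    smin U z = z ⬝ᵥ truncGibbs U c z + negEntropy (truncGibbs U c z) := by
  refine IsLeast.csInf_eq ⟨⟨_, truncGibbs_mem hU hc h, rfl⟩, ?_⟩
  rintro _ ⟨q, hq, rfl⟩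
  simpa using truncGibbs_lower_bound hU hc h hq 0

lemma smin_add_ge (hU : 0 < U) (hc : 0 < c) (h : ∑ i, truncGibbs U c z i = 1)
    (v : Fin n → ℝ) :
    smin U z + ∑ i, truncGibbs U c z i * (1 - Real.exp (-v i)) ≤ smin U (z + v) := by
  rw [smin_eq hU hc h]
  refine le_csInf (Set.Nonempty.image _ ⟨_, truncGibbs_mem hU hc h⟩) ?_
  rintro _ ⟨q, hq, rfl⟩
  exact truncGibbs_lower_bound hU hc h hq v

lemma smin_le (hU : 0 < U) (hn : 1 ≤ n * U) (z : Fin n → ℝ) {r : Fin n → ℝ}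
    (hr : r ∈ truncSimplex n U) : smin U z ≤ z ⬝ᵥ r + negEntropy r := by
  obtain ⟨c, hc, h⟩ := exists_sum_truncGibbs_eq_one hU hn z
  have := bddBelow_objective hU hc h 0
  rw [add_zero] at this
  exact csInf_le this ⟨r, hr, rfl⟩

lemma smin_add_le (hU : 0 < U) (hn : 1 ≤ n * U) (hc : 0 < c)
    (h : ∑ i, truncGibbs U c z i = 1) (v : Fin n → ℝ) :
    smin U (z + v) ≤ smin U z + truncGibbs U c z ⬝ᵥ v := by
  rw [smin_eq hU hc h]
  refine (smin_le hU hn (z + v) (truncGibbs_mem hU hc h)).trans (le_of_eq ?_)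
  rw [add_dotProduct, dotProduct_comm v]
  ring

/-- The bounds `smin_add_le` and `smin_add_ge` squeeze the increment between `⟨r, v⟩` and `⟨r, v⟩ -
‖v‖²`, so the remainder is quadratic. -/
lemma hasFDerivAt_smin (hU : 0 < U) (hn : 1 ≤ n * U) (hc : 0 < c)
    (h : ∑ i, truncGibbs U c z i = 1) :
    HasFDerivAt (smin (n := n) U)
      (∑ i, truncGibbs U c z i • (ContinuousLinearMap.proj i : (Fin n → ℝ) →L[ℝ] ℝ)) z := by
  set r := truncGibbs U c z with hr
  set L : (Fin n → ℝ) →L[ℝ] ℝ := ∑ i, r i • ContinuousLinearMap.proj i with hL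
  have hLv : ∀ v, L v = r ⬝ᵥ v := fun v => by
    simp [hL, dotProduct]
  have hO : (fun y => smin U y - smin U z - L (y - z)) =O[nhds z] fun y => ‖y - z‖ ^ 2 := by
    refine Asymptotics.IsBigO.of_bound 1 ?_
    filter_upwards [Metric.ball_mem_nhds z one_pos] with y hy
    have hy1 : ‖y - z‖ ≤ 1 := by rw [← dist_eq_norm]; exact (Metric.mem_ball.1 hy).le
    set v := y - z with hv
    have hyv : y = z + v := by simp [hv]
    have hup := smin_add_le hU hn hc h v
    have hlow := smin_add_ge hU hc h v
    rw [← hyv] at hup hlow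
    have hquad : r ⬝ᵥ v - ‖v‖ ^ 2 ≤ ∑ i, r i * (1 - Real.exp (-v i)) := by
      have : ∀ i, r i * v i - r i * ‖v‖ ^ 2 ≤ r i * (1 - Real.exp (-v i)) := by
        intro i
        rw [← mul_sub]
        refine mul_le_mul_of_nonneg_left ?_ (truncGibbs_pos hU hc i).le
        have h1 : |v i| ≤ ‖v‖ := norm_le_pi_norm v i
        have h2 := Real.abs_exp_sub_one_sub_id_le (x := -v i) (by rw [abs_neg]; linarith)
        have h3 : (-v i) ^ 2 ≤ ‖v‖ ^ 2 := by
          rw [neg_sq, ← sq_abs]; gcongr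
        have := (abs_le.1 h2).2
        linarith
      have hs := Finset.sum_le_sum fun i (_ : i ∈ Finset.univ) => this i
      rw [Finset.sum_sub_distrib, ← Finset.sum_mul, h, one_mul] at hs
      exact hs
    rw [hLv, one_mul, Real.norm_eq_abs, norm_pow, norm_norm, abs_le]
    constructor
    · linarith
    · have : (0 : ℝ) ≤ ‖v‖ ^ 2 := by positivity
      linarith
  have h0 := hO.hasFDerivAt (𝕜 := ℝ) one_lt_two
  have h1 := (h0.add (L.hasFDerivAt (x := z))).add_const (smin U z - L z)
  rw [zero_add] at h1
  refine h1.congr_of_eventuallyEq (Filter.Eventually.of_forall fun y => ?_)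
  simp only [map_sub, Pi.add_apply]
  ring

lemma gradSmin_eq (hU : 0 < U) (hn : 1 ≤ n * U) (hc : 0 < c)
    (h : ∑ i, truncGibbs U c z i = 1) : gradSmin U z = truncGibbs U c z := by
  funext i
  rw [gradSmin, (hasFDerivAt_smin hU hn hc h).fderiv]
  simp [Pi.single_apply]

/-- Here `D^U` is empty, and the infimum of the empty set is `0` by convention, so the softmin is
constant. -/
lemma gradSmin_eq_zero (hn : n * U < 1) (z : Fin n → ℝ) : gradSmin U z = 0 := by
  have he : truncSimplex n U = ∅ := by
    rw [Set.eq_empty_iff_forall_notMem]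
    rintro r ⟨-, hr, hrU⟩
    have := Finset.sum_le_sum fun i (_ : i ∈ Finset.univ) => hrU i
    rw [hr] at this
    simp at this
    linarith
  have hs : smin (n := n) U = fun _ => 0 := by
    funext x
    simp [smin, he]
  funext i
  simp [gradSmin, hs]

lemma gradSmin_mem (hU : 0 < U) (hn : 1 ≤ n * U) (z : Fin n → ℝ) :
    gradSmin U z ∈ truncSimplex n U := by
  obtain ⟨c, hc, h⟩ := exists_sum_truncGibbs_eq_one hU hn z
  rw [gradSmin_eq hU hn hc h]
  exact truncGibbs_mem hU hc h

/-- Smoothness of the truncated softmin along nonnegative directions. -/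
lemma smin_add_ge_of_nonneg (hU : 0 < U) (hn : 1 ≤ n * U) (z : Fin n → ℝ) {v : Fin n → ℝ}
    {b : ℝ} (hv : ∀ i, 0 ≤ v i) (hb : ∀ i, v i ≤ b) :
    smin U z + (1 - b / 2) * (gradSmin U z ⬝ᵥ v) ≤ smin U (z + v) := by
  obtain ⟨c, hc, h⟩ := exists_sum_truncGibbs_eq_one hU hn z
  rw [gradSmin_eq hU hn hc h]
  refine le_trans ?_ (smin_add_ge hU hc h v)
  rw [dotProduct, Finset.mul_sum]
  refine add_le_add le_rfl (Finset.sum_le_sum fun i _ => ?_)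
  -- Invert `1 + v + v²/2 ≤ e^v`, using `(1 - v + v²/2)(1 + v + v²/2) = 1 + v⁴/4 ≥ 1`.
  have h1 : Real.exp (-v i) ≤ 1 - v i + v i ^ 2 / 2 := by
    have h2 := Real.quadratic_le_exp_of_nonneg (hv i)
    have h3 : (1 - v i + v i ^ 2 / 2) * (1 + v i + v i ^ 2 / 2) = 1 + v i ^ 4 / 4 := by ring
    have h4 : 0 < 1 - v i + v i ^ 2 / 2 := by nlinarith [sq_nonneg (v i - 1)]
    rw [Real.exp_neg, inv_le_iff_one_le_mul₀ (Real.exp_pos _)]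
    have h5 := mul_le_mul_of_nonneg_left h2 h4.le
    have h6 : 0 ≤ v i ^ 4 / 4 := by positivity
    linarith
  have h2 : v i ^ 2 ≤ b * v i := by
    rw [sq]; exact mul_le_mul_of_nonneg_right (hb i) (hv i)
  calc (1 - b / 2) * (truncGibbs U c z i * v i)
      = truncGibbs U c z i * (v i - b * v i / 2) := by ring
    _ ≤ truncGibbs U c z i * (1 - Real.exp (-v i)) :=
      mul_le_mul_of_nonneg_left (by linarith) (truncGibbs_pos hU hc i).le

/-- Gibbs' inequality against the uniform distribution. -/
lemma smin_zero_ge (hU : 0 < U) (hn : 1 ≤ n * U) :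
    -Real.log n ≤ smin U (0 : Fin n → ℝ) := by
  obtain ⟨c, hc, h⟩ := exists_sum_truncGibbs_eq_one hU hn 0
  rw [smin_eq hU hc h, zero_dotProduct, zero_add, negEntropy]
  set r := truncGibbs U c (0 : Fin n → ℝ)
  have hn0 : 0 < (n : ℝ) := by
    by_contra hcon
    have : (n : ℝ) = 0 := le_antisymm (not_lt.1 hcon) (Nat.cast_nonneg n)
    rw [this] at hn
    norm_num at hn
  have key : ∀ i, r i - 1 / n - r i * Real.log n ≤ r i * Real.log (r i) := by
    intro i
    have hri : 0 < r i := truncGibbs_pos hU hc i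
    have h1 := Real.log_le_sub_one_of_pos (show 0 < 1 / (n * r i) by positivity)
    rw [one_div, Real.log_inv, Real.log_mul hn0.ne' hri.ne'] at h1
    have h2 := mul_le_mul_of_nonneg_left h1 hri.le
    have h3 : r i * ((n * r i)⁻¹ - 1) = 1 / n - r i := by field_simp
    rw [h3] at h2
    linarith
  have hs := Finset.sum_le_sum fun i (_ : i ∈ Finset.univ) => key i
  rw [Finset.sum_sub_distrib, Finset.sum_sub_distrib, ← Finset.sum_mul, h] at hs
  simp at hs
  rw [mul_inv_cancel₀ hn0.ne'] at hs
  linarith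

/-- If the truncation set has at least `1 / U` coordinates below `b`, then so is the softmin. -/
lemma smin_lt_of_card (hU : 0 < U) (hn : 1 ≤ n * U) (z : Fin n → ℝ) {b : ℝ} (S : Finset (Fin n))
    (hS : 1 / U ≤ S.card) (hz : ∀ i ∈ S, z i < b) : smin U z < b := by
  have hpos : 0 < (S.card : ℝ) := lt_of_lt_of_le (by positivity) hS
  have hne : S.Nonempty := Finset.card_pos.1 (by exact_mod_cast hpos)
  set r : Fin n → ℝ := fun i => if i ∈ S then 1 / (S.card : ℝ) else 0 with hr
  have hrm : r ∈ truncSimplex n U := by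
    refine ⟨fun i => ?_, ?_, fun i => ?_⟩
    · simp only [hr]; split_ifs <;> positivity
    · simp [hr, hpos.ne']
    · simp only [hr]
      split_ifs
      · rw [div_le_iff₀ hU] at hS
        rw [div_le_iff₀ hpos]
        linarith
      · exact hU.le
  have h1 : z ⬝ᵥ r < b := by
    have e : z ⬝ᵥ r = ∑ i ∈ S, z i * (1 / S.card) := by
      simp [dotProduct, hr, Finset.sum_ite_mem]
    rw [e]
    calc ∑ i ∈ S, z i * (1 / (S.card : ℝ)) < ∑ i ∈ S, b * (1 / (S.card : ℝ)) :=
          Finset.sum_lt_sum_of_nonempty hne fun i hi =>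
            mul_lt_mul_of_pos_right (hz i hi) (by positivity)
      _ = b := by rw [Finset.sum_const, nsmul_eq_mul]; field_simp
  have h2 : negEntropy r ≤ 0 := by
    refine Finset.sum_nonpos fun i _ => ?_
    have h0 : 0 ≤ r i := hrm.1 i
    have h1 : r i ≤ 1 := by
      rw [← hrm.2.1]
      exact Finset.single_le_sum (fun j _ => hrm.1 j) (Finset.mem_univ i)
    exact mul_nonpos_of_nonneg_of_nonpos h0 (Real.log_nonpos h0 h1)
  linarith [smin_le hU hn z hrm]

/-- If the normalizer grows, the claim is immediate. If it shrinks, every weight weakly decreases;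
as both totals are `1`, the weights all agree. -/
lemma truncGibbs_le_of_le (hc : 0 < c) {c' : ℝ} {z' : Fin n → ℝ} {k : Fin n}
    (hz : ∀ i, i ≠ k → z i = z' i) (hk : z k ≤ z' k) (h : ∑ i, truncGibbs U c z i = 1)
    (h' : ∑ i, truncGibbs U c' z' i = 1) {i : Fin n} (hi : i ≠ k) :
    truncGibbs U c z i ≤ truncGibbs U c' z' i := by
  rcases le_total c c' with hcc | hcc
  · unfold truncGibbs
    rw [hz i hi]
    gcongr
  · have hle : ∀ j ∈ Finset.univ, truncGibbs U c' z' j ≤ truncGibbs U c z j := by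
      intro j _
      have : z j ≤ z' j := by
        by_cases hj : j = k
        · rw [hj]; exact hk
        · exact (hz j hj).le
      unfold truncGibbs
      gcongr
    exact (((Finset.sum_eq_sum_iff_of_le hle).1 (h'.trans h.symm)) i (Finset.mem_univ i)).ge

end Gibbs

/-! ### Sensitivity of the linearized softmin to a change of one row -/

section Sensitivity

variable {n : ℕ} {U H : ℝ}

/-- Off `k`, the mass gained is the mass `r k - r' k ≤ U` lost at `k`, so that part of the product
rises by an amount in `[0, H U]`. The two terms at `k` lie in `[0, H U]` as well. -/
lemma abs_dotProduct_sub_le {r r' a a' : Fin n → ℝ} {k : Fin n} (hH : 0 ≤ H)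
    (hr : r ∈ truncSimplex n U) (hr' : r' ∈ truncSimplex n U)
    (hle : ∀ i, i ≠ k → r i ≤ r' i) (ha : ∀ i, 0 ≤ a i ∧ a i ≤ H)
    (ha' : ∀ i, 0 ≤ a' i ∧ a' i ≤ H) (haa : ∀ i, i ≠ k → a i = a' i) :
    |r ⬝ᵥ a - r' ⬝ᵥ a'| ≤ 2 * (H * U) := by
  have s1 := Finset.add_sum_erase Finset.univ r (Finset.mem_univ k)
  have s2 := Finset.add_sum_erase Finset.univ r' (Finset.mem_univ k)
  rw [hr.2.1] at s1
  rw [hr'.2.1] at s2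
  simp only [dotProduct]
  rw [← Finset.add_sum_erase Finset.univ (fun i => r i * a i) (Finset.mem_univ k),
    ← Finset.add_sum_erase Finset.univ (fun i => r' i * a' i) (Finset.mem_univ k)]
  have e1 : ∑ i ∈ Finset.univ.erase k, r i * a i ≤ ∑ i ∈ Finset.univ.erase k, r' i * a' i :=
    Finset.sum_le_sum fun i hi => by
      have hik := Finset.ne_of_mem_erase hi
      rw [haa i hik]
      exact mul_le_mul_of_nonneg_right (hle i hik) (ha' i).1
  have e2 : ∑ i ∈ Finset.univ.erase k, r' i * a' i ≤
      ∑ i ∈ Finset.univ.erase k, (r i * a i + (r' i - r i) * H) :=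
    Finset.sum_le_sum fun i hi => by
      have hik := Finset.ne_of_mem_erase hi
      have := mul_le_mul_of_nonneg_left (ha' i).2 (sub_nonneg.2 (hle i hik))
      rw [haa i hik]
      linarith
  rw [Finset.sum_add_distrib, ← Finset.sum_mul, Finset.sum_sub_distrib] at e2
  have e3 : (∑ i ∈ Finset.univ.erase k, r' i - ∑ i ∈ Finset.univ.erase k, r i) * H ≤ H * U := by
    rw [mul_comm]
    refine mul_le_mul_of_nonneg_left ?_ hH
    linarith [hr'.1 k, hr.2.2 k]
  have b1 : r k * a k ≤ H * U := by
    rw [mul_comm]; exact mul_le_mul (ha k).2 (hr.2.2 k) (hr.1 k) hH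
  have b2 : r' k * a' k ≤ H * U := by
    rw [mul_comm]; exact mul_le_mul (ha' k).2 (hr'.2.2 k) (hr'.1 k) hH
  have b3 : 0 ≤ r k * a k := mul_nonneg (hr.1 k) (ha k).1
  have b4 : 0 ≤ r' k * a' k := mul_nonneg (hr'.1 k) (ha' k).1
  rw [abs_le]
  constructor <;> linarith

/-- Changing one row changes the linearized softmin by at most `2 H U`. -/
lemma abs_gradSmin_dotProduct_sub_le (hU : 0 < U) (hH : 0 ≤ H) {z z' a a' : Fin n → ℝ}
    {k : Fin n} (hz : ∀ i, i ≠ k → z i = z' i) (ha : ∀ i, 0 ≤ a i ∧ a i ≤ H)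
    (ha' : ∀ i, 0 ≤ a' i ∧ a' i ≤ H) (haa : ∀ i, i ≠ k → a i = a' i) :
    |gradSmin U z ⬝ᵥ a - gradSmin U z' ⬝ᵥ a'| ≤ 2 * (H * U) := by
  rcases lt_or_ge (n * U) 1 with hn | hn
  · rw [gradSmin_eq_zero hn, gradSmin_eq_zero hn]
    simp
    positivity
  obtain ⟨c, hc, h⟩ := exists_sum_truncGibbs_eq_one hU hn z
  obtain ⟨c', hc', h'⟩ := exists_sum_truncGibbs_eq_one hU hn z'
  rw [gradSmin_eq hU hn hc h, gradSmin_eq hU hn hc' h']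
  have m := truncGibbs_mem hU hc h
  have m' := truncGibbs_mem hU hc' h'
  rcases le_total (z k) (z' k) with hk | hk
  · exact abs_dotProduct_sub_le hH m m'
      (fun i hi => truncGibbs_le_of_le hc hz hk h h' hi) ha ha' haa
  · rw [abs_sub_comm]
    exact abs_dotProduct_sub_le hH m' m
      (fun i hi => truncGibbs_le_of_le hc' (fun i hi => (hz i hi).symm) hk h' h hi) ha' ha
      (fun i hi => (haa i hi).symm)

end Sensitivity

end PrivateCovering

namespace PrivateCovering

/-! ### Composition of randomized algorithms via Hölder's inequality -/

section Renyi

/-- Expectations under `p` are controlled by `L^b`-norms under `q`; for `b = a / (a - 1)` this is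
the dual form of a bound on the Rényi divergence of order `a`. -/
def HolderDominated {X : Type*} (M : ENNReal) (b : ℝ) (p q : PMF X) : Prop :=
  ∀ f : X → ENNReal, ∑' x, p x * f x ≤ M * (∑' x, q x * f x ^ b) ^ (1 / b)

variable {X Y : Type*} {b : ℝ}

lemma tsum_bind_mul (p : PMF X) (k : X → PMF Y) (f : Y → ENNReal) :
    ∑' y, (p.bind k) y * f y = ∑' x, p x * ∑' y, k x y * f y := by
  simp only [PMF.bind_apply, ← ENNReal.tsum_mul_right, ← ENNReal.tsum_mul_left]
  rw [ENNReal.tsum_comm]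
  simp only [mul_assoc]

lemma tsum_pure_mul (x : X) (f : X → ENNReal) : ∑' y, (PMF.pure x) y * f y = f x := by
  classical
  rw [tsum_eq_single x]
  · simp
  · intro y hy
    simp [PMF.pure_apply, hy]

lemma HolderDominated.pure (hb : 0 < b) (x : X) :
    HolderDominated 1 b (PMF.pure x) (PMF.pure x) := by
  intro f
  rw [tsum_pure_mul, tsum_pure_mul x (fun y => f y ^ b), one_mul, ← ENNReal.rpow_mul,
    mul_one_div_cancel hb.ne', ENNReal.rpow_one]

/-- Apply the inner bound at each `x`, then the outer one to the function `x ↦ (∑ l x · f^b)^{1/b}`: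
its `b`-th power undoes the root, so the constants multiply even though `k` and `l` depend on the
previous output. -/
lemma HolderDominated.bind (hb : 0 < b) {M N : ENNReal} {p q : PMF X} {k l : X → PMF Y}
    (h : HolderDominated M b p q) (hk : ∀ x, HolderDominated N b (k x) (l x)) :
    HolderDominated (M * N) b (p.bind k) (q.bind l) := by
  intro f
  rw [tsum_bind_mul, tsum_bind_mul q l (fun y => f y ^ b)]
  calc ∑' x, p x * ∑' y, k x y * f y
      ≤ ∑' x, p x * (N * (∑' y, l x y * f y ^ b) ^ (1 / b)) := by
        gcongr with x
        exact hk x f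
    _ = N * ∑' x, p x * (∑' y, l x y * f y ^ b) ^ (1 / b) := by
        rw [← ENNReal.tsum_mul_left]
        congr 1; funext x; ring
    _ ≤ N * (M * (∑' x, q x * ((∑' y, l x y * f y ^ b) ^ (1 / b)) ^ b) ^ (1 / b)) := by
        gcongr
        exact h _
    _ = M * N * (∑' x, q x * ∑' y, l x y * f y ^ b) ^ (1 / b) := by
        simp only [← ENNReal.rpow_mul, one_div_mul_cancel hb.ne', ENNReal.rpow_one]
        ring

lemma HolderDominated.map (hb : 0 < b) {M : ENNReal} {p q : PMF X}
    (h : HolderDominated M b p q) (g : X → Y) : HolderDominated M b (p.map g) (q.map g) := by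
  have := h.bind (N := 1) hb (k := fun x => PMF.pure (g x)) (l := fun x => PMF.pure (g x))
    fun x => HolderDominated.pure hb _
  rw [mul_one] at this
  exact this

lemma HolderDominated.toOuterMeasure_le (hb : 0 < b) {M : ENNReal} {p q : PMF X}
    (h : HolderDominated M b p q) (O : Set X) :
    p.toOuterMeasure O ≤ M * q.toOuterMeasure O ^ (1 / b) := by
  classical
  have h1 := h (O.indicator 1)
  have e : ∀ r : PMF X, r.toOuterMeasure O = ∑' x, r x * O.indicator 1 x := by
    intro r
    rw [PMF.toOuterMeasure_apply]
    congr 1; funext x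
    by_cases hx : x ∈ O <;> simp [hx]
  have e2 : ∀ x, (O.indicator (1 : X → ENNReal) x) ^ b = O.indicator 1 x := by
    intro x
    by_cases hx : x ∈ O <;> simp [hx, hb]
  simp only [e2] at h1
  rwa [← e, ← e] at h1

/-- A Rényi divergence bound implies approximate differential privacy. -/
lemma HolderDominated.toOuterMeasure_le_exp_mul_add {a ρ ε δ : ℝ} (ha : 1 < a) (hδ : 0 < δ)
    (hε : a * ρ + Real.log (1 / δ) / (a - 1) ≤ ε) {p q : PMF X}
    (h : HolderDominated (ENNReal.ofReal (Real.exp ((a - 1) * ρ))) (a / (a - 1)) p q)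
    (O : Set X) :
    p.toOuterMeasure O
      ≤ ENNReal.ofReal (Real.exp ε) * q.toOuterMeasure O + ENNReal.ofReal δ := by
  have ha1 : 0 < a - 1 := by linarith
  have ha0 : 0 < a := by linarith
  refine (h.toOuterMeasure_le (by positivity) O).trans ?_
  have hq1 : q.toOuterMeasure O ≠ ⊤ :=
    ne_top_of_le_ne_top q.tsum_coe_ne_top (by
      rw [PMF.toOuterMeasure_apply]
      exact ENNReal.tsum_le_tsum fun x => Set.indicator_le_self _ _ x)
  set x := (q.toOuterMeasure O).toReal with hx
  have hx0 : 0 ≤ x := ENNReal.toReal_nonneg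
  rw [← ENNReal.ofReal_toReal hq1, ← hx, ENNReal.ofReal_rpow_of_nonneg hx0 (by positivity),
    ← ENNReal.ofReal_mul (Real.exp_pos _).le, ← ENNReal.ofReal_mul (Real.exp_pos _).le,
    ← ENNReal.ofReal_add (by positivity) hδ.le]
  refine ENNReal.ofReal_le_ofReal ?_
  have hθ : 1 / (a / (a - 1)) = (a - 1) / a := by rw [one_div_div]
  rw [hθ]
  have hw : (a - 1) / a + 1 / a = 1 := by field_simp; ring
  -- Weighted AM–GM splits the product into a multiplicative and an additive error; `hε` says
  -- exactly that the constant is at most `e^{ε(a-1)/a} δ^{1/a}`.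
  have am := Real.geom_mean_le_arith_mean2_weighted (w₁ := (a - 1) / a) (w₂ := 1 / a)
    (p₁ := Real.exp ε * x) (p₂ := δ) (by positivity) (by positivity) (by positivity) hδ.le hw
  have hlow : Real.exp ((a - 1) * ρ) ≤ Real.exp ε ^ ((a - 1) / a) * δ ^ (1 / a) := by
    rw [← Real.exp_mul, Real.rpow_def_of_pos hδ, ← Real.exp_add, Real.exp_le_exp]
    rw [one_div, Real.log_inv] at hε
    have h2 := mul_le_mul_of_nonneg_left hε (show 0 ≤ (a - 1) / a by positivity)
    have h3 : (a - 1) / a * (a * ρ + -Real.log δ / (a - 1))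
        = (a - 1) * ρ - Real.log δ * (1 / a) := by field_simp; ring
    rw [h3] at h2
    linarith
  have ha1' : (a - 1) / a ≤ 1 := by rw [div_le_one ha0]; linarith
  have ha2' : 1 / a ≤ 1 := by rw [div_le_one ha0]; linarith
  calc Real.exp ((a - 1) * ρ) * x ^ ((a - 1) / a)
      ≤ Real.exp ε ^ ((a - 1) / a) * δ ^ (1 / a) * x ^ ((a - 1) / a) := by gcongr
    _ = (Real.exp ε * x) ^ ((a - 1) / a) * δ ^ (1 / a) := by
        rw [Real.mul_rpow (Real.exp_pos _).le hx0]; ring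
    _ ≤ (a - 1) / a * (Real.exp ε * x) + 1 / a * δ := am
    _ ≤ 1 * (Real.exp ε * x) + 1 * δ := by gcongr
    _ = Real.exp ε * x + δ := by ring

/-! ### Rényi divergence of distributions with bounded likelihood ratio -/

lemma sinh_le_mul_cosh {y : ℝ} (hy : 0 ≤ y) : Real.sinh y ≤ y * Real.cosh y := by
  have hd : ∀ x : ℝ, HasDerivAt (fun y => y * Real.cosh y - Real.sinh y) (x * Real.sinh x) x := by
    intro x
    have := ((hasDerivAt_id x).mul (Real.hasDerivAt_cosh x)).sub (Real.hasDerivAt_sinh x)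
    refine this.congr_deriv ?_
    simp
  have hm : MonotoneOn (fun y => y * Real.cosh y - Real.sinh y) (Set.Ici 0) := by
    refine monotoneOn_of_deriv_nonneg (convex_Ici 0) (by fun_prop) (by fun_prop) ?_
    intro x hx
    rw [interior_Ici] at hx
    rw [(hd x).deriv]
    exact mul_nonneg hx.le (Real.sinh_nonneg_iff.2 hx.le)
  have := hm (Set.mem_Ici.2 le_rfl) (Set.mem_Ici.2 hy) hy
  simp at this
  linarith

/-- The function `cosh y · e^{-y²/2}` decreases on `[0, ∞)`, since `sinh y ≤ y cosh y`. -/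
lemma cosh_div_cosh_le {x y : ℝ} (hx : 0 ≤ x) (hxy : x ≤ y) :
    Real.cosh y / Real.cosh x ≤ Real.exp ((y ^ 2 - x ^ 2) / 2) := by
  have hd : ∀ x : ℝ, HasDerivAt (fun y => Real.cosh y * Real.exp (-(y ^ 2 / 2)))
      ((Real.sinh x - x * Real.cosh x) * Real.exp (-(x ^ 2 / 2))) x := by
    intro x
    have h1 : HasDerivAt (fun y : ℝ => -(y ^ 2 / 2)) (-x) x := by
      have := ((hasDerivAt_pow 2 x).div_const 2).neg
      refine this.congr_deriv ?_
      simp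
    refine ((Real.hasDerivAt_cosh x).mul h1.exp).congr_deriv ?_
    ring
  have hm : AntitoneOn (fun y => Real.cosh y * Real.exp (-(y ^ 2 / 2))) (Set.Ici 0) := by
    refine antitoneOn_of_deriv_nonpos (convex_Ici 0) (by fun_prop) (by fun_prop) ?_
    intro x hx
    rw [interior_Ici] at hx
    rw [(hd x).deriv]
    exact mul_nonpos_of_nonpos_of_nonneg (by linarith [sinh_le_mul_cosh (le_of_lt hx)])
      (Real.exp_pos _).le
  have h1 := hm (Set.mem_Ici.2 hx) (Set.mem_Ici.2 (hx.trans hxy)) hxy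
  simp only at h1
  rw [div_le_iff₀ (Real.cosh_pos x)]
  have h2 := mul_le_mul_of_nonneg_right h1 (Real.exp_pos (y ^ 2 / 2)).le
  rw [mul_assoc, mul_assoc, ← Real.exp_add, ← Real.exp_add] at h2
  simp only [neg_add_cancel, Real.exp_zero, mul_one] at h2
  calc Real.cosh y ≤ _ := h2
    _ = Real.exp ((y ^ 2 - x ^ 2) / 2) * Real.cosh x := by
      rw [mul_comm]; congr 2; ring

lemma exp_mul_sinh_add (y x : ℝ) :
    Real.exp (-(y + x)) * Real.sinh (x + x) + (1 - Real.exp (-(x + x))) * Real.sinh (y + x)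
      = 2 * Real.cosh y * Real.sinh x := by
  simp only [Real.sinh_eq, Real.cosh_eq, Real.exp_neg, Real.exp_add]
  have := (Real.exp_pos x).ne'
  have := (Real.exp_pos y).ne'
  field_simp
  ring

/-- The Rényi divergence of order `a` of two distributions whose likelihood ratio lies in
`[e^{-ε}, e^ε]` is at most `a ε² / 2`. -/
lemma sum_mul_rpow_le {ι : Type*} [Fintype ι] {a ε : ℝ} (ha : 1 < a) (hε : 0 < ε) {p q : ι → ℝ}
    (hq0 : ∀ i, 0 < q i) (hp : ∑ i, p i = 1) (hq : ∑ i, q i = 1)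
    (hpq : ∀ i, p i ≤ Real.exp ε * q i) (hqp : ∀ i, q i ≤ Real.exp ε * p i) :
    ∑ i, q i * (p i / q i) ^ a ≤ Real.exp (a * (a - 1) * ε ^ 2 / 2) := by
  have hs : 0 < Real.sinh ε := Real.sinh_pos_iff.2 hε
  have hsne := hs.ne'
  -- The convex function `t^a` lies below its chord over `[e^{-ε}, e^ε]`. The ratio has `q`-mean
  -- `1`, so averaging evaluates the chord at `t = 1`.
  have hch : ∀ i, (p i / q i) ^ a ≤ Real.exp (-(a * ε))
      + (p i / q i - Real.exp (-ε)) * (Real.sinh (a * ε) / Real.sinh ε) := by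
    intro i
    set t := p i / q i with ht
    have ht1 : t ≤ Real.exp ε := by rw [ht, div_le_iff₀ (hq0 i)]; exact hpq i
    have ht2 : Real.exp (-ε) ≤ t := by
      rw [ht, le_div_iff₀ (hq0 i), Real.exp_neg, inv_mul_le_iff₀ (Real.exp_pos _)]
      exact hqp i
    have hw : Real.exp ε - Real.exp (-ε) = 2 * Real.sinh ε := by rw [Real.sinh_eq]; ring
    have hconv := (convexOn_rpow ha.le).2 (Real.exp_pos (-ε)).le (Real.exp_pos ε).le
      (show 0 ≤ (Real.exp ε - t) / (2 * Real.sinh ε) from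
        div_nonneg (by linarith) (by positivity))
      (show 0 ≤ (t - Real.exp (-ε)) / (2 * Real.sinh ε) from
        div_nonneg (by linarith) (by positivity))
      (by rw [← add_div, ← hw, div_eq_one_iff_eq (by rw [hw]; positivity)]; ring)
    have e1 : ((Real.exp ε - t) / (2 * Real.sinh ε)) • Real.exp (-ε)
        + ((t - Real.exp (-ε)) / (2 * Real.sinh ε)) • Real.exp ε = t := by
      rw [smul_eq_mul, smul_eq_mul, ← hw]
      have : Real.exp ε - Real.exp (-ε) ≠ 0 := by rw [hw]; positivity
      field_simp
      ring
    rw [e1] at hconv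
    simp only [← Real.exp_mul] at hconv
    refine hconv.trans (le_of_eq ?_)
    have e2 : Real.exp (ε * a) = Real.exp (-(a * ε)) + 2 * Real.sinh (a * ε) := by
      rw [Real.sinh_eq, mul_comm ε a]; ring
    have e3 : Real.exp ε = Real.exp (-ε) + 2 * Real.sinh ε := by linarith
    rw [smul_eq_mul, smul_eq_mul, e2, e3, show -ε * a = -(a * ε) by ring]
    field_simp
    ring
  have hsum : ∑ i, q i * (p i / q i) ^ a ≤ Real.exp (-(a * ε))
      + (1 - Real.exp (-ε)) * (Real.sinh (a * ε) / Real.sinh ε) := by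
    calc ∑ i, q i * (p i / q i) ^ a
        ≤ ∑ i, q i * (Real.exp (-(a * ε))
            + (p i / q i - Real.exp (-ε)) * (Real.sinh (a * ε) / Real.sinh ε)) :=
          Finset.sum_le_sum fun i _ => mul_le_mul_of_nonneg_left (hch i) (hq0 i).le
      _ = ∑ i, (q i * Real.exp (-(a * ε)) + (p i - q i * Real.exp (-ε))
            * (Real.sinh (a * ε) / Real.sinh ε)) := by
          refine Finset.sum_congr rfl fun i _ => ?_
          have := (hq0 i).ne'
          field_simp
      _ = _ := by
          rw [Finset.sum_add_distrib, ← Finset.sum_mul, ← Finset.sum_mul,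
            Finset.sum_sub_distrib, ← Finset.sum_mul, hp, hq]
          ring
  refine hsum.trans ?_
  -- The value of the chord at `1` is a ratio of hyperbolic cosines, and `(a - 1/2)² - 1/4 = a (a -
  -- 1)` produces the final exponent.
  have e4 : Real.exp (-(a * ε)) + (1 - Real.exp (-ε)) * (Real.sinh (a * ε) / Real.sinh ε)
      = Real.cosh ((a - 1 / 2) * ε) / Real.cosh (ε / 2) := by
    have hc := (Real.cosh_pos (ε / 2)).ne'
    have hs2 : Real.sinh (ε / 2) ≠ 0 := (Real.sinh_pos_iff.2 (by linarith)).ne'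
    have f1 : Real.sinh ε = 2 * Real.sinh (ε / 2) * Real.cosh (ε / 2) := by
      rw [← Real.sinh_two_mul]; congr 1; ring
    have f2 : Real.exp (-(a * ε)) * Real.sinh ε + (1 - Real.exp (-ε)) * Real.sinh (a * ε)
        = 2 * Real.cosh ((a - 1 / 2) * ε) * Real.sinh (ε / 2) := by
      have g1 : a * ε = (a - 1 / 2) * ε + ε / 2 := by ring
      have g2 := exp_mul_sinh_add ((a - 1 / 2) * ε) (ε / 2)
      rwa [← g1, add_halves] at g2
    rw [f1] at f2 ⊢
    generalize Real.cosh ((a - 1 / 2) * ε) = G at f2 ⊢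
    field_simp
    linarith
  rw [e4]
  refine (cosh_div_cosh_le (by positivity) (by nlinarith)).trans (le_of_eq ?_)
  congr 1
  ring

/-- Pure differential privacy implies a Rényi divergence bound. -/
lemma holderDominated_of_le_exp_mul {ι : Type*} [Fintype ι] {a ε : ℝ} (ha : 1 < a) (hε : 0 < ε)
    {P Q : PMF ι} {p q : ι → ℝ} (hP : ∀ i, P i = ENNReal.ofReal (p i))
    (hQ : ∀ i, Q i = ENNReal.ofReal (q i))
    (hp0 : ∀ i, 0 < p i) (hq0 : ∀ i, 0 < q i) (hp : ∑ i, p i = 1) (hq : ∑ i, q i = 1)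
    (hpq : ∀ i, p i ≤ Real.exp ε * q i) (hqp : ∀ i, q i ≤ Real.exp ε * p i) :
    HolderDominated (ENNReal.ofReal (Real.exp ((a - 1) * (ε ^ 2 / 2)))) (a / (a - 1)) P Q := by
  intro f
  have ha1 : 0 < a - 1 := by linarith
  have ha0 : 0 < a := by linarith
  set b := a / (a - 1) with hb
  have hab : a.HolderConjugate b := by
    rw [Real.holderConjugate_iff]
    refine ⟨ha, ?_⟩
    rw [hb]; field_simp; ring
  have hb0 : 0 < b := hab.symm.pos
  rw [tsum_fintype, tsum_fintype]
  -- Hölder for the factorization `p f = ((p/q) q^{1/a}) · (q^{1/b} f)`; the first factor is the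
  -- Rényi moment.
  have h1 := ENNReal.inner_le_Lp_mul_Lq Finset.univ
    (fun i => ENNReal.ofReal (p i / q i * q i ^ (1 / a)))
    (fun i => ENNReal.ofReal (q i ^ (1 / b)) * f i) hab
  have e1 : ∀ i, ENNReal.ofReal (p i / q i * q i ^ (1 / a)) *
      (ENNReal.ofReal (q i ^ (1 / b)) * f i) = P i * f i := by
    intro i
    have hqi := hq0 i
    have hpi := hp0 i
    rw [hP, ← mul_assoc, ← ENNReal.ofReal_mul (by positivity), mul_assoc (p i / q i),
      ← Real.rpow_add hqi]
    have : 1 / a + 1 / b = 1 := by simpa using hab.inv_add_inv_eq_one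
    rw [this, Real.rpow_one, div_mul_cancel₀ _ hqi.ne']
  have e2 : ∀ i, ENNReal.ofReal (p i / q i * q i ^ (1 / a)) ^ a
      = ENNReal.ofReal (q i * (p i / q i) ^ a) := by
    intro i
    have hqi := hq0 i
    have hpi := hp0 i
    rw [ENNReal.ofReal_rpow_of_nonneg (by positivity) ha0.le,
      Real.mul_rpow (by positivity) (by positivity), ← Real.rpow_mul hqi.le,
      one_div_mul_cancel ha0.ne', Real.rpow_one, mul_comm]
  have e3 : ∀ i, (ENNReal.ofReal (q i ^ (1 / b)) * f i) ^ b = Q i * f i ^ b := by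
    intro i
    have hqi := hq0 i
    rw [ENNReal.mul_rpow_of_nonneg _ _ hb0.le, ENNReal.ofReal_rpow_of_nonneg (by positivity) hb0.le,
      ← Real.rpow_mul hqi.le, one_div_mul_cancel hb0.ne', Real.rpow_one, hQ]
  simp only [e1, e2, e3] at h1
  refine h1.trans (mul_le_mul_left ?_ _)
  rw [← ENNReal.ofReal_sum_of_nonneg fun i _ => by
    have hqi := hq0 i
    have hpi := hp0 i
    positivity]
  refine (ENNReal.rpow_le_rpow (ENNReal.ofReal_le_ofReal
    (sum_mul_rpow_le ha hε hq0 hp hq hpq hqp)) (by positivity)).trans (le_of_eq ?_)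
  rw [ENNReal.ofReal_rpow_of_pos (Real.exp_pos _), ← Real.exp_mul]
  congr 2
  field_simp

end Renyi

/-! ### The exponential mechanism -/

section ExpMechanism

variable {S : Type*} [Fintype S] [Nonempty S]

lemma sum_exp_pos (g : S → ℝ) : 0 < ∑ j, Real.exp (g j) :=
  Finset.sum_pos (fun _ _ => Real.exp_pos _) Finset.univ_nonempty

lemma expMechanism_apply (ε Δ : ℝ) (Q : S → ℝ) (j : S) :
    expMechanism ε Δ Q j = ENNReal.ofReal (Real.exp (ε * Q j / (2 * Δ))
      / ∑ i, Real.exp (ε * Q i / (2 * Δ))) := by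
  rw [expMechanism, PMF.normalize_apply, tsum_fintype,
    ← ENNReal.ofReal_sum_of_nonneg fun i _ => (Real.exp_pos _).le,
    ENNReal.ofReal_div_of_pos (sum_exp_pos _)]
  exact (div_eq_mul_inv _ _).symm

/-- The numerator and the normalizing sum each contribute a factor `e^{ε/2}`. -/
lemma exp_div_sum_le {ε : ℝ} {g g' : S → ℝ} (h : ∀ j, |g j - g' j| ≤ ε / 2) (j : S) :
    Real.exp (g j) / ∑ i, Real.exp (g i)
      ≤ Real.exp ε * (Real.exp (g' j) / ∑ i, Real.exp (g' i)) := by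
  have h1 : Real.exp (g j) ≤ Real.exp (ε / 2) * Real.exp (g' j) := by
    rw [← Real.exp_add, Real.exp_le_exp]
    linarith [(abs_le.1 (h j)).2]
  have h2 : ∑ i, Real.exp (g' i) ≤ Real.exp (ε / 2) * ∑ i, Real.exp (g i) := by
    rw [Finset.mul_sum]
    refine Finset.sum_le_sum fun i _ => ?_
    rw [← Real.exp_add, Real.exp_le_exp]
    linarith [(abs_le.1 (h i)).1]
  have hs := sum_exp_pos g
  have hs' := sum_exp_pos g'
  rw [← mul_div_assoc, div_le_div_iff₀ hs hs']
  calc Real.exp (g j) * ∑ i, Real.exp (g' i)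
      ≤ Real.exp (ε / 2) * Real.exp (g' j) * (Real.exp (ε / 2) * ∑ i, Real.exp (g i)) := by
        gcongr
    _ = Real.exp (ε / 2) * Real.exp (ε / 2) * Real.exp (g' j) * ∑ i, Real.exp (g i) := by ring
    _ = _ := by rw [← Real.exp_add, add_halves]

lemma holderDominated_expMechanism {a ε Δ : ℝ} (ha : 1 < a) (hε : 0 < ε) (hΔ : 0 < Δ)
    {Q Q' : S → ℝ} (h : ∀ j, |Q j - Q' j| ≤ Δ) :
    HolderDominated (ENNReal.ofReal (Real.exp ((a - 1) * (ε ^ 2 / 2)))) (a / (a - 1))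
      (expMechanism ε Δ Q) (expMechanism ε Δ Q') := by
  have hd : ∀ j, |ε * Q j / (2 * Δ) - ε * Q' j / (2 * Δ)| ≤ ε / 2 := by
    intro j
    rw [← sub_div, ← mul_sub, abs_div, abs_mul, abs_of_pos hε, abs_of_pos (by positivity : 0 < 2 * Δ),
      div_le_iff₀ (by positivity)]
    calc ε * |Q j - Q' j| ≤ ε * Δ := by gcongr; exact h j
      _ = _ := by ring
  refine holderDominated_of_le_exp_mul ha hε (expMechanism_apply ε Δ Q) (expMechanism_apply ε Δ Q')
    (fun i => div_pos (Real.exp_pos _) (sum_exp_pos _))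
    (fun i => div_pos (Real.exp_pos _) (sum_exp_pos _)) ?_ ?_ (exp_div_sum_le hd)
    (exp_div_sum_le fun j => by rw [abs_sub_comm]; exact hd j)
  · rw [← Finset.sum_div, div_self (sum_exp_pos _).ne']
  · rw [← Finset.sum_div, div_self (sum_exp_pos _).ne']

/-- The exponential mechanism is unlikely to output a point whose score is far from maximal. -/
lemma expMechanism_tail {ε Δ γ : ℝ} (hε : 0 < ε) (hΔ : 0 < Δ) (hγ : 0 < γ) (Q : S → ℝ) (m : S) :
    (expMechanism ε Δ Q).toOuterMeasure
        {j | Q j < Q m - 2 * Δ / ε * (Real.log (Fintype.card S) + Real.log (1 / γ))}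
      ≤ ENNReal.ofReal γ := by
  classical
  set B : Set S := {j | Q j < Q m - 2 * Δ / ε * (Real.log (Fintype.card S) + Real.log (1 / γ))}
  set W := ∑ i, Real.exp (ε * Q i / (2 * Δ)) with hW
  have hWpos : 0 < W := sum_exp_pos _
  have hcard : (0 : ℝ) < Fintype.card S := by exact_mod_cast Fintype.card_pos
  have hm : Real.exp (ε * Q m / (2 * Δ)) ≤ W :=
    Finset.single_le_sum (f := fun i => Real.exp (ε * Q i / (2 * Δ)))
      (fun i _ => (Real.exp_pos _).le) (Finset.mem_univ m)
  -- Union bound: each bad outcome has mass at most `γ / |S|`, since the normalizer is at least the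
  -- weight of `m`.
  have hpt : ∀ j, B.indicator (expMechanism ε Δ Q) j ≤ ENNReal.ofReal (γ / Fintype.card S) := by
    intro j
    by_cases hj : j ∈ B
    · rw [Set.indicator_of_mem hj, expMechanism_apply]
      refine ENNReal.ofReal_le_ofReal ?_
      rw [← hW, div_le_iff₀ hWpos]
      refine le_trans ?_ (mul_le_mul_of_nonneg_left hm (by positivity))
      have h1 : γ / Fintype.card S
          = Real.exp (-(Real.log (Fintype.card S) + Real.log (1 / γ))) := by
        rw [neg_add, Real.exp_add, Real.exp_neg, Real.exp_log hcard, ← Real.log_inv, one_div,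
          inv_inv, Real.exp_log hγ]
        field_simp
      rw [h1, ← Real.exp_add, Real.exp_le_exp]
      have h2 : Q j < Q m - 2 * Δ / ε * (Real.log (Fintype.card S) + Real.log (1 / γ)) := hj
      have h3 := mul_le_mul_of_nonneg_left h2.le (show 0 ≤ ε / (2 * Δ) by positivity)
      have h4 : ε / (2 * Δ) * (Q m - 2 * Δ / ε * (Real.log (Fintype.card S) + Real.log (1 / γ)))
          = -(Real.log (Fintype.card S) + Real.log (1 / γ)) + ε * Q m / (2 * Δ) := by
        field_simp
        ring
      rw [h4] at h3
      refine le_trans (le_of_eq ?_) h3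
      ring
    · rw [Set.indicator_of_notMem hj]
      exact zero_le
  rw [PMF.toOuterMeasure_apply, tsum_fintype]
  refine (Finset.sum_le_sum fun j _ => hpt j).trans (le_of_eq ?_)
  rw [Finset.sum_const, nsmul_eq_mul, Finset.card_univ, ← ENNReal.ofReal_natCast,
    ← ENNReal.ofReal_mul hcard.le]
  congr 1
  field_simp

end ExpMechanism

end PrivateCovering

namespace PrivateCovering

namespace Params

/-! ### Basic properties of the parameters and of the pre-processing -/

section Basic

variable {P : Params} {n d : ℕ}

lemma log_natCast_pos (hn : 2 ≤ n) : 0 < Real.log n :=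
  Real.log_pos (by exact_mod_cast hn)

lemma Valid.log_inv_δ_pos (hP : P.Valid) : 0 < Real.log (1 / P.δ) :=
  Real.log_pos (by rw [lt_div_iff₀ hP.δ_mem.1, one_mul]; exact hP.δ_mem.2)

/-- Without pre-processing `R` may be nonpositive; the natural-number ceiling then gives `T = 0`. -/
lemma Valid.H_pos_of_T_pos (hP : P.Valid) (hT : 0 < P.T n d) : 0 < P.H d := by
  by_contra hH
  have hopt := hP.opt_pos
  have hlog : 0 ≤ Real.log n := Real.log_natCast_nonneg n
  refine hT.ne' (Nat.ceil_eq_zero.2 ?_)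
  refine div_nonpos_of_nonpos_of_nonneg ?_ (sq_nonneg _)
  have h1 : 20 * P.H d * P.opt ≤ 0 :=
    mul_nonpos_of_nonpos_of_nonneg (by linarith) hopt.le
  exact mul_nonpos_of_nonpos_of_nonneg h1 hlog

lemma Valid.T_pos (hP : P.Valid) (hn : 2 ≤ n) (hH : 0 < P.H d) : 0 < P.T n d := by
  have hopt := hP.opt_pos
  have hα := hP.α_mem.1
  have hlog := log_natCast_pos hn
  exact Nat.ceil_pos.2 (by positivity)

lemma Valid.ε'_pos (hP : P.Valid) (hT : 0 < P.T n d) : 0 < P.ε' n d := by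
  have h1 := hP.log_inv_δ_pos
  have h2 : (0 : ℝ) < P.T n d := by exact_mod_cast hT
  have h3 := hP.ε_pos
  rw [ε']
  positivity

lemma Valid.log_d_add_log_pos [NeZero d] (hP : P.Valid) (hT : 0 < P.T n d) :
    0 < Real.log d + Real.log (P.T n d / P.β) := by
  have h2 : (1 : ℝ) ≤ P.T n d := by exact_mod_cast hT
  refine add_pos_of_nonneg_of_pos (Real.log_natCast_nonneg d) (Real.log_pos ?_)
  rw [lt_div_iff₀ hP.β_mem.1]
  linarith [hP.β_mem.2]

lemma Valid.s_pos [NeZero d] (hP : P.Valid) (hT : 0 < P.T n d) : 0 < P.s n d := by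
  have h1 := hP.ε'_pos hT
  have h2 := hP.log_d_add_log_pos hT
  have h3 := hP.H_pos_of_T_pos hT
  have h4 := hP.opt_pos
  have h5 := hP.α_mem.1
  rw [s]
  positivity

lemma Valid.U_pos [NeZero d] (hP : P.Valid) (hT : 0 < P.T n d) : 0 < P.U n d :=
  one_div_pos.2 (hP.s_pos hT)

lemma Valid.Δ_pos [NeZero d] (hP : P.Valid) (hT : 0 < P.T n d) : 0 < P.Δ n d := by
  have h1 := hP.s_pos hT
  have h3 := hP.H_pos_of_T_pos hT
  have h4 := hP.opt_pos
  rw [Δ]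
  positivity

lemma Valid.H_pos_of_clip [NeZero d] (hP : P.Valid) (hc : P.clip = true) : 0 < P.H d := by
  have h4 := hP.opt_pos
  have h5 := hP.α_mem.1
  have hd : (0 : ℝ) < d := by exact_mod_cast Nat.pos_of_ne_zero (NeZero.ne d)
  rw [H, if_pos hc]
  positivity

lemma preprocess_mem [NeZero d] (hP : P.Valid) {A : Matrix (Fin n) (Fin d) ℝ}
    (hA : A ∈ P.inputs n d) (i : Fin n) (j : Fin d) :
    0 ≤ P.preprocess A i j ∧ P.preprocess A i j ≤ P.H d := by
  cases hc : P.clip with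
  | false =>
    simp only [preprocess, H, hc]
    exact ⟨hA.1 i j, hA.2 hc i j⟩
  | true =>
    have := hP.H_pos_of_clip (d := d) hc
    simp only [preprocess, hc, if_true, Matrix.map_apply]
    exact ⟨le_min (hA.1 i j) this.le, min_le_right _ _⟩

lemma preprocess_le (A : Matrix (Fin n) (Fin d) ℝ) (i : Fin n) (j : Fin d) :
    P.preprocess A i j ≤ A i j := by
  unfold preprocess
  split_ifs
  · simp
  · exact le_rfl

lemma preprocess_congr {A A' : Matrix (Fin n) (Fin d) ℝ} {i : Fin n} (h : A i = A' i)
    (j : Fin d) : P.preprocess A i j = P.preprocess A' i j := by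
  unfold preprocess
  split_ifs <;> simp [h]

end Basic

/-! ### Privacy -/

section Privacy

variable {P : Params} {n d : ℕ} [NeZero d]

lemma abs_score_sub_le (hP : P.Valid) (hT : 0 < P.T n d) {B B' : Matrix (Fin n) (Fin d) ℝ}
    {k : Fin n} (hB : ∀ i j, 0 ≤ B i j ∧ B i j ≤ P.H d)
    (hB' : ∀ i j, 0 ≤ B' i j ∧ B' i j ≤ P.H d) (h : ∀ i, i ≠ k → B i = B' i)
    (x : Fin d → ℝ) (j : Fin d) : |P.score B x j - P.score B' x j| ≤ P.Δ n d := by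
  have hU := hP.U_pos hT
  have hH := hP.H_pos_of_T_pos hT
  have hopt := hP.opt_pos
  have hs := hP.s_pos hT
  rw [score, score, ← sub_mul, abs_mul, abs_of_pos hopt, Matrix.mulVec_single_one,
    Matrix.mulVec_single_one]
  have h1 := abs_gradSmin_dotProduct_sub_le hU hH.le (z := P.η d • (B *ᵥ x))
    (z' := P.η d • (B' *ᵥ x)) (a := B.col j) (a' := B'.col j) (k := k)
    (fun i hi => by simp [Matrix.mulVec, h i hi]) (fun i => hB i j) (fun i => hB' i j)
    (fun i hi => by simp [Matrix.col, h i hi])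
  refine (mul_le_mul_of_nonneg_right h1 hopt.le).trans ?_
  have e : P.Δ n d = 3 * (P.H d * P.U n d) * P.opt := by rw [Δ, U]; ring
  rw [e]
  have : 0 ≤ P.H d * P.U n d * P.opt := by positivity
  linarith

lemma holderDominated_iterate {a : ℝ} (ha : 1 < a) (hP : P.Valid) (hT : 0 < P.T n d)
    {B B' : Matrix (Fin n) (Fin d) ℝ} {k : Fin n} (hB : ∀ i j, 0 ≤ B i j ∧ B i j ≤ P.H d)
    (hB' : ∀ i j, 0 ≤ B' i j ∧ B' i j ≤ P.H d) (h : ∀ i, i ≠ k → B i = B' i) (t : ℕ) :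
    HolderDominated (ENNReal.ofReal (Real.exp ((a - 1) * (P.ε' n d ^ 2 / 2))) ^ t) (a / (a - 1))
      (P.iterate B t) (P.iterate B' t) := by
  have hb : 0 < a / (a - 1) := div_pos (by linarith) (by linarith)
  induction t with
  | zero => simpa [iterate] using HolderDominated.pure hb _
  | succ t ih =>
    rw [pow_succ]
    exact ih.bind hb fun x =>
      (holderDominated_expMechanism ha (hP.ε'_pos hT) (hP.Δ_pos hT)
        (abs_score_sub_le hP hT hB hB' h x)).map hb _

/-- The algorithm is differentially private. -/
theorem isDP_algorithm (hP : P.Valid) :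
    IsDP (P.inputs n d) Neighbors (fun A => P.algorithm A) P.ε P.δ := by
  intro A hA A' hA' ⟨k, hk⟩ O
  rcases Nat.eq_zero_or_pos (P.T n d) with hT | hT
  -- With no iterations the output does not depend on the input.
  · have e : P.algorithm A = P.algorithm A' := by simp [algorithm, hT, iterate]
    simp only [e]
    refine le_trans ?_ le_self_add
    refine le_mul_of_one_le_left' ?_
    rw [ENNReal.one_le_ofReal]
    exact Real.one_le_exp hP.ε_pos.le
  have hl := hP.log_inv_δ_pos
  have hε := hP.ε_pos
  have hT' : (0 : ℝ) < P.T n d := by exact_mod_cast hT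
  set l := Real.log (1 / P.δ) with hldef
  -- The Rényi order is `1 + κ`. The total budget is `ρ = ε²/(8l)`, and this `κ` balances `κ ρ` and
  -- `l / κ`, both equal to `(√2/4) ε`.
  set κ := 2 * Real.sqrt 2 * l / P.ε with hκ
  have hκ0 : 0 < κ := by positivity
  have hdom := (holderDominated_iterate (a := 1 + κ) (k := k) (by linarith) hP hT
    (preprocess_mem hP hA) (preprocess_mem hP hA')
    (fun i hi => funext fun j => preprocess_congr (hk i hi) j) (P.T n d)).map
    (div_pos (by linarith) (by linarith)) fun x => (P.T n d : ℝ)⁻¹ • x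
  rw [← ENNReal.ofReal_pow (Real.exp_pos _).le, ← Real.exp_nat_mul] at hdom
  have hε' : P.ε' n d ^ 2 = P.ε ^ 2 / (4 * (P.T n d * l)) := by
    rw [ε', ← hldef, div_pow, mul_pow, Real.sq_sqrt (by positivity),
      show (2 : ℝ) ^ 2 = 4 by norm_num]
  have e : (P.T n d : ℝ) * ((1 + κ - 1) * (P.ε' n d ^ 2 / 2))
      = (1 + κ - 1) * (P.ε ^ 2 / (8 * l)) := by
    rw [hε']; field_simp; ring
  rw [e] at hdom
  refine hdom.toOuterMeasure_le_exp_mul_add (by linarith) hP.δ_mem.1 ?_ O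
  rw [← hldef, add_sub_cancel_left]
  have h2 : Real.sqrt 2 * Real.sqrt 2 = 2 := Real.mul_self_sqrt (by norm_num)
  have h2p : 0 < Real.sqrt 2 := by positivity
  have e1 : κ * (P.ε ^ 2 / (8 * l)) = Real.sqrt 2 / 4 * P.ε := by
    rw [hκ]; field_simp; ring
  have e2 : l / κ = Real.sqrt 2 / 4 * P.ε := by
    rw [hκ]; field_simp; linarith
  -- The remaining summand `1 · ρ` must fit into `ε - ε/√2`; this is what `Valid.ε_le` provides.
  have e3 : P.ε ^ 2 / (8 * l) ≤ (1 - Real.sqrt 2 / 2) * P.ε := by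
    rw [div_le_iff₀ (by positivity)]
    have := mul_le_mul_of_nonneg_left hP.ε_le hε.le
    rw [← hldef] at this
    linarith
  rw [add_mul, e1, e2]
  linarith

end Privacy

/-! ### The objective value -/

section Objective

variable {P : Params} {n d : ℕ} [NeZero d]

lemma mem_support_iterate (hP : P.Valid) (B : Matrix (Fin n) (Fin d) ℝ) (t : ℕ) :
    ∀ x ∈ (P.iterate B t).support, (∀ j, 0 ≤ x j) ∧ ∑ j, x j = t * P.opt := by
  induction t with
  | zero =>
    intro x hx
    simp only [iterate, PMF.support_pure, Set.mem_singleton_iff] at hx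
    simp [hx]
  | succ t ih =>
    intro x hx
    simp only [iterate, PMF.mem_support_bind_iff, PMF.mem_support_map_iff] at hx
    obtain ⟨y, hy, j, -, rfl⟩ := hx
    obtain ⟨h1, h2⟩ := ih y hy
    refine ⟨fun i => add_nonneg (h1 i) ?_, ?_⟩
    · rw [Pi.single_apply]
      split_ifs
      · exact hP.opt_pos.le
      · exact le_rfl
    · simp only [Pi.add_apply, Finset.sum_add_distrib, h2, Finset.sum_pi_single', Finset.mem_univ,
        if_true, Nat.cast_succ]
      ring

lemma mem_support_algorithm (hP : P.Valid) {A : Matrix (Fin n) (Fin d) ℝ} {x : Fin d → ℝ}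
    (hx : x ∈ (P.algorithm A).support) :
    (∀ j, 0 ≤ x j) ∧ (0 < P.T n d → ∑ j, x j = P.opt) ∧ ∑ j, x j ≤ P.opt := by
  simp only [algorithm, PMF.mem_support_map_iff] at hx
  obtain ⟨y, hy, rfl⟩ := hx
  obtain ⟨h1, h2⟩ := mem_support_iterate hP _ _ y hy
  have h3 : ∑ j, ((P.T n d : ℝ)⁻¹ • y) j = (P.T n d : ℝ)⁻¹ * (P.T n d * P.opt) := by
    rw [← h2, Finset.mul_sum]; rfl
  refine ⟨fun j => mul_nonneg (by positivity) (h1 j), fun hT => ?_, ?_⟩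
  · have hT' : (P.T n d : ℝ) ≠ 0 := by exact_mod_cast hT.ne'
    rw [h3, inv_mul_cancel_left₀ hT']
  · rw [h3]
    rcases Nat.eq_zero_or_pos (P.T n d) with hT | hT
    · simp [hT, hP.opt_pos.le]
    · have hT' : (P.T n d : ℝ) ≠ 0 := by exact_mod_cast hT.ne'
      rw [inv_mul_cancel_left₀ hT']

end Objective

end Params

end PrivateCovering

namespace PrivateCovering

namespace Params

/-! ### Accuracy of the covering oracle and progress of the potential -/

section Progress

variable {P : Params} {n d : ℕ}

lemma score_eq (B : Matrix (Fin n) (Fin d) ℝ) (x : Fin d → ℝ) (j : Fin d) :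
    P.score B x j = (gradSmin (P.U n d) (P.η d • (B *ᵥ x)) ⬝ᵥ B.col j) * P.opt := by
  rw [score, Matrix.mulVec_single_one]

variable [NeZero d]

/-- Some coordinate has a score close to `1` if the LP with matrix `B` has an almost optimal
solution `y`. -/
lemma exists_score_ge (hP : P.Valid) (hT : 0 < P.T n d) (hU : 1 ≤ n * P.U n d)
    {B : Matrix (Fin n) (Fin d) ℝ} (hB : ∀ i j, 0 ≤ B i j)
    {y : Fin d → ℝ} (hy : y ∈ feasible B) (hys : ∑ j, y j ≤ (1 + P.α / 40) * P.opt)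
    (x : Fin d → ℝ) : ∃ m, 1 - P.α / 40 ≤ P.score B x m := by
  obtain ⟨m, hm⟩ := Finite.exists_max (P.score B x)
  refine ⟨m, ?_⟩
  have hopt := hP.opt_pos
  have hα := hP.α_mem.1
  obtain ⟨hr0, hr1, -⟩ := gradSmin_mem (hP.U_pos hT) hU (P.η d • (B *ᵥ x))
  set r := gradSmin (P.U n d) (P.η d • (B *ᵥ x)) with hr
  have hs : ∀ j, P.score B x j = (r ⬝ᵥ B.col j) * P.opt := score_eq B x
  have hm0 : 0 ≤ P.score B x m := by
    rw [hs]
    exact mul_nonneg (Finset.sum_nonneg fun i _ => mul_nonneg (hr0 i) (hB i m)) hopt.le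
  -- Averaging: the scores weighted by `y` sum to `OPT · ⟨r, By⟩ ≥ OPT`, while the weights sum to at
  -- most `(1 + α/40) OPT`.
  have h1 : ∑ j, P.score B x j * y j = P.opt * (r ⬝ᵥ (B *ᵥ y)) := by
    simp only [hs, dotProduct, Matrix.mulVec, Matrix.col_apply, Finset.mul_sum, Finset.sum_mul]
    rw [Finset.sum_comm]
    refine Finset.sum_congr rfl fun i _ => Finset.sum_congr rfl fun j _ => by ring
  have h2 : 1 ≤ r ⬝ᵥ (B *ᵥ y) := by
    rw [← hr1]
    exact Finset.sum_le_sum fun i _ => le_mul_of_one_le_right (hr0 i) (hy.2 i)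
  have h3 : ∑ j, P.score B x j * y j ≤ P.score B x m * ((1 + P.α / 40) * P.opt) := by
    calc ∑ j, P.score B x j * y j ≤ ∑ j, P.score B x m * y j :=
          Finset.sum_le_sum fun j _ => mul_le_mul_of_nonneg_right (hm j) (hy.1 j)
      _ = P.score B x m * ∑ j, y j := by rw [Finset.mul_sum]
      _ ≤ _ := mul_le_mul_of_nonneg_left hys hm0
  have h4 : P.opt ≤ P.opt * (P.score B x m * (1 + P.α / 40)) := by
    have := mul_le_mul_of_nonneg_left h2 hopt.le
    linarith
  have h5 : 1 ≤ P.score B x m * (1 + P.α / 40) := by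
    by_contra hcon
    have := mul_lt_mul_of_pos_left (not_le.1 hcon) hopt
    linarith
  by_contra hcon
  have h6 := mul_lt_mul_of_pos_right (not_le.1 hcon) (show 0 < 1 + P.α / 40 by positivity)
  nlinarith

/-- The constant `120` in `s` makes the loss of the exponential mechanism exactly `α/20`, on top of
the `α/40` from `exists_score_ge`. -/
lemma oracle_tail (hP : P.Valid) (hT : 0 < P.T n d) (hU : 1 ≤ n * P.U n d)
    {B : Matrix (Fin n) (Fin d) ℝ} (hB : ∀ i j, 0 ≤ B i j)
    {y : Fin d → ℝ} (hy : y ∈ feasible B) (hys : ∑ j, y j ≤ (1 + P.α / 40) * P.opt)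
    (x : Fin d → ℝ) :
    (P.oracle B x).toOuterMeasure {j | P.score B x j < 1 - 3 * P.α / 40}
      ≤ ENNReal.ofReal (P.β / P.T n d) := by
  obtain ⟨m, hm⟩ := exists_score_ge hP hT hU hB hy hys x
  have hT' : (0 : ℝ) < P.T n d := by exact_mod_cast hT
  have hε := hP.ε'_pos hT
  have hL := hP.log_d_add_log_pos hT
  have hH := hP.H_pos_of_T_pos hT
  have hopt := hP.opt_pos
  have hα := hP.α_mem.1
  refine le_trans ?_ (expMechanism_tail hε (hP.Δ_pos hT)
    (div_pos hP.β_mem.1 hT') (P.score B x) m)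
  refine (P.oracle B x).toOuterMeasure.mono ?_
  intro j hj
  simp only [Set.mem_ofPred_eq] at hj ⊢
  have e : 2 * P.Δ n d / P.ε' n d * (Real.log d + Real.log (P.T n d / P.β)) = P.α / 20 := by
    rw [Δ, s]
    field_simp
    norm_num
  rw [one_div_div, Fintype.card_fin, e]
  linarith

/-- The step size keeps every increment below `α/10`, so smoothness costs a factor `1 - α/20`;
together with the oracle loss `3α/40` this makes `α/8`. -/
lemma smin_step (hP : P.Valid) (hT : 0 < P.T n d) (hU : 1 ≤ n * P.U n d)
    {B : Matrix (Fin n) (Fin d) ℝ} (hB : ∀ i j, 0 ≤ B i j ∧ B i j ≤ P.H d)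
    (x : Fin d → ℝ) {j : Fin d} (hj : 1 - 3 * P.α / 40 ≤ P.score B x j) :
    smin (P.U n d) (P.η d • (B *ᵥ x)) + P.η d * (1 - P.α / 8)
      ≤ smin (P.U n d) (P.η d • (B *ᵥ (x + Pi.single j P.opt))) := by
  have hH := hP.H_pos_of_T_pos hT
  have hopt := hP.opt_pos
  have hα := hP.α_mem.1
  have hα1 := hP.α_mem.2
  have hη : 0 < P.η d := by rw [η]; positivity
  have hηH : P.η d * P.opt * P.H d = P.α / 10 := by rw [η]; field_simp
  have e : P.η d • (B *ᵥ (x + Pi.single j P.opt))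
      = P.η d • (B *ᵥ x) + (P.η d * P.opt) • B.col j := by
    rw [Matrix.mulVec_add, smul_add, mul_smul]
    congr 2
    funext i
    simp [mul_comm]
  rw [e]
  refine le_trans ?_ (smin_add_ge_of_nonneg (b := P.α / 10) (hP.U_pos hT) hU _
    (fun i => mul_nonneg (by positivity) (hB i j).1)
    (fun i => by rw [← hηH]; exact mul_le_mul_of_nonneg_left (hB i j).2 (by positivity)))
  rw [dotProduct_smul, smul_eq_mul, mul_assoc (P.η d), mul_comm P.opt, ← score_eq]
  have h1 : 1 - P.α / 8 ≤ (1 - P.α / 10 / 2) * P.score B x j := by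
    have := mul_le_mul_of_nonneg_left hj (show 0 ≤ 1 - P.α / 10 / 2 by linarith)
    nlinarith
  have := mul_le_mul_of_nonneg_left h1 hη.le
  linarith

/-- With probability at least `1 - t β / T` the potential has made progress in each of the first
`t` iterations. -/
lemma iterate_bad_le (hP : P.Valid) (hT : 0 < P.T n d) (hU : 1 ≤ n * P.U n d)
    {B : Matrix (Fin n) (Fin d) ℝ} (hB : ∀ i j, 0 ≤ B i j ∧ B i j ≤ P.H d)
    {y : Fin d → ℝ} (hy : y ∈ feasible B) (hys : ∑ j, y j ≤ (1 + P.α / 40) * P.opt) (t : ℕ) :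
    (P.iterate B t).toOuterMeasure
        {x | smin (P.U n d) (P.η d • (B *ᵥ x)) < -Real.log n + t * (P.η d * (1 - P.α / 8))}
      ≤ t * ENNReal.ofReal (P.β / P.T n d) := by
  induction t with
  | zero =>
    have := smin_zero_ge (hP.U_pos hT) hU
    simp [iterate, this]
  | succ t ih =>
    set γ := ENNReal.ofReal (P.β / P.T n d)
    set Bad : Set (Fin d → ℝ) :=
      {x | smin (P.U n d) (P.η d • (B *ᵥ x)) < -Real.log n + t * (P.η d * (1 - P.α / 8))}
    set Bad' : Set (Fin d → ℝ) :=
      {x | smin (P.U n d) (P.η d • (B *ᵥ x))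
        < -Real.log n + (t + 1 : ℕ) * (P.η d * (1 - P.α / 8))}
    rw [iterate, PMF.toOuterMeasure_bind_apply]
    -- The next point is bad only if the current one already is, or if the oracle fails at a good
    -- one.
    have hpt : ∀ x, P.iterate B t x *
        ((P.oracle B x).map fun j => x + Pi.single j P.opt).toOuterMeasure Bad'
          ≤ Bad.indicator (P.iterate B t) x + P.iterate B t x * γ := by
      intro x
      by_cases hx : x ∈ Bad
      · rw [Set.indicator_of_mem hx]
        refine le_trans ?_ le_self_add
        refine mul_le_of_le_one_right' ?_
        rw [PMF.toOuterMeasure_apply, ← PMF.tsum_coe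
          ((P.oracle B x).map fun j => x + Pi.single j P.opt)]
        exact ENNReal.tsum_le_tsum fun x => Set.indicator_le_self _ _ x
      · refine le_trans ?_ le_add_self
        refine mul_le_mul_right ?_ _
        rw [PMF.toOuterMeasure_map_apply]
        refine le_trans ((P.oracle B x).toOuterMeasure.mono ?_)
          (oracle_tail hP hT hU (fun i j => (hB i j).1) hy hys x)
        intro j hj
        simp only [Bad', Set.mem_preimage, Set.mem_ofPred_eq] at hj ⊢
        by_contra hcon
        have h1 := smin_step hP hT hU hB x (not_lt.1 hcon)
        simp only [Bad, Set.mem_ofPred_eq, not_lt] at hx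
        push_cast at hj
        linarith
    refine (ENNReal.tsum_le_tsum hpt).trans ?_
    rw [ENNReal.tsum_add, ENNReal.tsum_mul_right, PMF.tsum_coe, one_mul, Nat.cast_succ, add_mul,
      one_mul, ← PMF.toOuterMeasure_apply]
    exact add_le_add ih le_rfl

end Progress

/-! ### The number of violated constraints -/

section Violated

variable {P : Params} {n d : ℕ}

/-- The optimal value is attained, and pre-processing almost keeps it. -/
lemma exists_feasible_preprocess [NeZero d] (hP : P.Valid) {A : Matrix (Fin n) (Fin d) ℝ}
    (hA : A ∈ P.inputs n d) (hopt : IsOptimalValue A P.opt) :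
    ∃ y ∈ feasible (P.preprocess A), ∑ j, y j ≤ (1 + P.α / 40) * P.opt := by
  obtain ⟨x, hx, hxs⟩ := hopt.1
  simp only at hxs
  have ho := hP.opt_pos
  have hα := hP.α_mem.1
  cases hc : P.clip with
  | false =>
    refine ⟨x, ?_, ?_⟩
    · simpa [preprocess, hc] using hx
    · rw [hxs]; nlinarith
  | true =>
    have hd : (0 : ℝ) < d := by exact_mod_cast Nat.pos_of_ne_zero (NeZero.ne d)
    -- Shifting every coordinate by `w = 1/H` costs `d w = α OPT / 40`. A row with an entry reaching
    -- `H` is then satisfied by that entry alone; other rows are unaffected by clipping.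
    set w := P.α * P.opt / (40 * d) with hw
    have hw0 : 0 < w := by positivity
    have hHw : P.H d * w = 1 := by
      rw [H, if_pos hc, hw]; field_simp
    refine ⟨fun j => x j + w, ⟨fun j => add_nonneg (hx.1 j) hw0.le, fun i => ?_⟩, ?_⟩
    · have hnn : ∀ j, 0 ≤ P.preprocess A i j := fun j => (preprocess_mem hP hA i j).1
      simp only [Matrix.mulVec, dotProduct]
      by_cases hex : ∃ j, P.H d ≤ A i j
      · obtain ⟨j, hj⟩ := hex
        have e : P.preprocess A i j = P.H d := by simp [preprocess, hc, hj]
        calc (1 : ℝ) = P.preprocess A i j * w := by rw [e, hHw]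
          _ ≤ P.preprocess A i j * (x j + w) :=
            mul_le_mul_of_nonneg_left (by linarith [hx.1 j]) (hnn j)
          _ ≤ _ := Finset.single_le_sum (f := fun j => P.preprocess A i j * (x j + w))
            (fun j _ => mul_nonneg (hnn j) (add_nonneg (hx.1 j) hw0.le)) (Finset.mem_univ j)
      · push Not at hex
        refine (hx.2 i).trans ?_
        simp only [Matrix.mulVec, dotProduct]
        refine Finset.sum_le_sum fun j _ => ?_
        have e : P.preprocess A i j = A i j := by simp [preprocess, hc, (hex j).le]
        rw [e]
        exact mul_le_mul_of_nonneg_left (by linarith) (hA.1 i j)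
    · rw [Finset.sum_add_distrib, hxs, Finset.sum_const, Finset.card_univ, Fintype.card_fin,
        nsmul_eq_mul, hw]
      apply le_of_eq
      field_simp

lemma one_le_mul_opt {A : Matrix (Fin n) (Fin d) ℝ} (hn : 2 ≤ n)
    (hopt : IsOptimalValue A P.opt) {b : ℝ} (hb : ∀ i j, A i j ≤ b) : 1 ≤ b * P.opt := by
  obtain ⟨x, hx, hxs⟩ := hopt.1
  simp only at hxs
  refine (hx.2 ⟨0, by omega⟩).trans ?_
  rw [← hxs, Finset.mul_sum]
  simp only [Matrix.mulVec, dotProduct]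
  exact Finset.sum_le_sum fun j _ => mul_le_mul_of_nonneg_right (hb _ j) (hx.1 j)

lemma one_le_H_mul_opt [NeZero d] (hP : P.Valid) (hn : 2 ≤ n) {A : Matrix (Fin n) (Fin d) ℝ}
    (hA : A ∈ P.inputs n d) (hopt : IsOptimalValue A P.opt) : 1 ≤ P.H d * P.opt := by
  have ho := hP.opt_pos
  have hα := hP.α_mem.1
  cases hc : P.clip with
  | false =>
    rw [H, hc]
    exact one_le_mul_opt hn hopt (hA.2 hc)
  | true =>
    have hd : (1 : ℝ) ≤ d := by exact_mod_cast Nat.pos_of_ne_zero (NeZero.ne d)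
    rw [H, if_pos hc]
    have : 40 * (d : ℝ) / (P.α * P.opt) * P.opt = 40 * d / P.α := by field_simp
    rw [this, le_div_iff₀ hα]
    linarith [hP.α_mem.2]

lemma Valid.T_pos_of_isOptimalValue [NeZero d] (hP : P.Valid) (hn : 2 ≤ n)
    {A : Matrix (Fin n) (Fin d) ℝ} (hA : A ∈ P.inputs n d) (hopt : IsOptimalValue A P.opt) :
    0 < P.T n d := by
  have h := one_le_H_mul_opt hP hn hA hopt
  exact hP.T_pos hn (pos_of_mul_pos_left (by linarith) hP.opt_pos.le)

lemma numViolated_le (A : Matrix (Fin n) (Fin d) ℝ) (α : ℝ) (x : Fin d → ℝ) :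
    numViolated A α x ≤ n := by
  unfold numViolated
  have := Set.ncard_le_card {i : Fin n | (A *ᵥ x) i < 1 - α}
  simpa using this

lemma violatesAtMost_of_support [NeZero d] (hP : P.Valid) {A : Matrix (Fin n) (Fin d) ℝ} {b : ℝ}
    (h : ∀ x ∈ (P.algorithm A).support, (numViolated A P.α x : ℝ) ≤ b) :
    P.ViolatesAtMost A b := by
  have h1 : (P.algorithm A).toOuterMeasure {x | (numViolated A P.α x : ℝ) ≤ b} = 1 :=
    (PMF.toOuterMeasure_apply_eq_one_iff _ _).2 h
  rw [ViolatesAtMost, h1, ENNReal.ofReal_le_one]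
  linarith [hP.β_mem.1]

lemma ViolatesAtMost.mono [NeZero d] {A : Matrix (Fin n) (Fin d) ℝ} {b b' : ℝ}
    (h : P.ViolatesAtMost A b) (hb : b ≤ b') : P.ViolatesAtMost A b' :=
  h.trans ((P.algorithm A).toOuterMeasure.mono fun _ hx => le_trans hx hb)

/-- Large potential forces few violated constraints. -/
lemma numViolated_le_of_smin_ge [NeZero d] (hP : P.Valid) (hT : 0 < P.T n d)
    (hU : 1 ≤ n * P.U n d) (A : Matrix (Fin n) (Fin d) ℝ) {x : Fin d → ℝ} (hx : ∀ j, 0 ≤ x j)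
    (h : -Real.log n + P.T n d * (P.η d * (1 - P.α / 8))
      ≤ smin (P.U n d) (P.η d • (P.preprocess A *ᵥ x))) :
    (numViolated A P.α ((P.T n d : ℝ)⁻¹ • x) : ℝ) ≤ P.s n d := by
  classical
  by_contra hcon
  rw [not_le] at hcon
  have hT' : (0 : ℝ) < P.T n d := by exact_mod_cast hT
  have hH := hP.H_pos_of_T_pos hT
  have ho := hP.opt_pos
  have hα := hP.α_mem.1
  have hη : 0 < P.η d := by rw [η]; positivity
  -- The number of iterations is chosen so that the initial deficit `ln n` is at most half of `α T
  -- η`.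
  have hlog : Real.log n ≤ P.α / 2 * (P.T n d * P.η d) := by
    have h1 : 20 * P.H d * P.opt * Real.log n / P.α ^ 2 ≤ P.T n d := Nat.le_ceil _
    have h2 := mul_le_mul_of_nonneg_right h1 (show 0 ≤ P.α / 2 * P.η d by positivity)
    have h3 : 20 * P.H d * P.opt * Real.log n / P.α ^ 2 * (P.α / 2 * P.η d) = Real.log n := by
      rw [η]; field_simp; ring
    rw [h3] at h2
    linarith
  set S : Finset (Fin n) := {i | (A *ᵥ ((P.T n d : ℝ)⁻¹ • x)) i < 1 - P.α} with hS
  have hcard : numViolated A P.α ((P.T n d : ℝ)⁻¹ • x) = S.card := by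
    rw [numViolated, ← Set.ncard_coe_finset]
    congr 1
    ext i
    simp [hS]
  rw [hcard] at hcon
  have hlt := smin_lt_of_card (hP.U_pos hT) hU (P.η d • (P.preprocess A *ᵥ x))
    (b := P.T n d * P.η d * (1 - P.α)) S (by rw [U, one_div_one_div]; exact hcon.le) (by
      intro i hi
      simp only [hS, Finset.mem_filter, Finset.mem_univ, true_and, Matrix.mulVec_smul,
        Pi.smul_apply, smul_eq_mul] at hi
      -- Clipping only lowers entries, so a violated original row also has a small value in the
      -- clipped matrix.
      have h1 : (P.preprocess A *ᵥ x) i ≤ (A *ᵥ x) i := by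
        simp only [Matrix.mulVec, dotProduct]
        exact Finset.sum_le_sum fun j _ =>
          mul_le_mul_of_nonneg_right (preprocess_le A i j) (hx j)
      rw [inv_mul_lt_iff₀ hT'] at hi
      rw [Pi.smul_apply, smul_eq_mul, mul_comm (P.T n d : ℝ), mul_assoc]
      exact mul_lt_mul_of_pos_left (h1.trans_lt hi) hη)
  -- The potential would be below `Tη(1 - α)`, yet it is at least `Tη(1 - α/8 - α/2)`.
  have hpos : 0 < P.T n d * P.η d * P.α := by positivity
  nlinarith

/-- With probability at least `1 - β` at most `s` constraints are violated. -/
theorem violatesAtMost_s [NeZero d] (hP : P.Valid) (hn : 2 ≤ n) {A : Matrix (Fin n) (Fin d) ℝ}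
    (hA : A ∈ P.inputs n d) (hopt : IsOptimalValue A P.opt) :
    P.ViolatesAtMost A (P.s n d) := by
  have hT := hP.T_pos_of_isOptimalValue hn hA hopt
  have hT' : (0 : ℝ) < P.T n d := by exact_mod_cast hT
  have hs := hP.s_pos hT
  rcases lt_or_ge (n * P.U n d) 1 with hU | hU
  -- If `D^U` is empty then `s > n`, so the bound is trivial.
  · refine violatesAtMost_of_support hP fun x _ => ?_
    rw [U, mul_one_div, div_lt_one hs] at hU
    exact le_trans (by exact_mod_cast numViolated_le A P.α x) hU.le
  obtain ⟨y, hy, hys⟩ := exists_feasible_preprocess hP hA hopt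
  have hbad := iterate_bad_le hP hT hU (preprocess_mem hP hA) hy hys (P.T n d)
  set μ := P.iterate (P.preprocess A) (P.T n d) with hμ
  set Bad : Set (Fin d → ℝ) := {x | smin (P.U n d) (P.η d • (P.preprocess A *ᵥ x))
    < -Real.log n + P.T n d * (P.η d * (1 - P.α / 8))} with hBad
  set G : Set (Fin d → ℝ) :=
    {x | (numViolated A P.α ((P.T n d : ℝ)⁻¹ • x) : ℝ) ≤ P.s n d} with hG
  have e : (P.algorithm A).toOuterMeasure {x | (numViolated A P.α x : ℝ) ≤ P.s n d}
      = μ.toOuterMeasure G := by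
    rw [algorithm, PMF.toOuterMeasure_map_apply]
    rfl
  have hone : μ.toOuterMeasure (G ∪ Bad) = 1 := by
    refine (PMF.toOuterMeasure_apply_eq_one_iff _ _).2 fun x hx => ?_
    by_cases hxB : x ∈ Bad
    · exact Or.inr hxB
    · exact Or.inl (numViolated_le_of_smin_ge hP hT hU A
        (mem_support_iterate hP _ _ x hx).1 (not_lt.1 hxB))
  have hβ : (P.T n d : ENNReal) * ENNReal.ofReal (P.β / P.T n d) = ENNReal.ofReal P.β := by
    rw [← ENNReal.ofReal_natCast, ← ENNReal.ofReal_mul hT'.le]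
    congr 1
    field_simp
  rw [hβ] at hbad
  rw [ViolatesAtMost, e, ENNReal.ofReal_sub _ hP.β_mem.1.le, ENNReal.ofReal_one, ← hone]
  refine tsub_le_iff_right.2 ((MeasureTheory.measure_union_le G Bad).trans ?_)
  exact add_le_add le_rfl hbad

end Violated

end Params

end PrivateCovering

namespace PrivateCovering

namespace Params

/-! ### Bounding the number of violated constraints in terms of the input -/

section Bounds

variable {P : Params} {n d : ℕ}

lemma half_le_log_natCast (hn : 2 ≤ n) : 1 / 2 ≤ Real.log n := by
  have h1 : Real.log 2 ≤ Real.log n := Real.log_le_log (by norm_num) (by exact_mod_cast hn)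
  linarith [Real.log_two_gt_d9]

/-- The quantity under the ceiling is at least `10`, so rounding up is absorbed in passing from `20`
to `25`. -/
lemma Valid.T_le (hP : P.Valid) (hn : 2 ≤ n) (hHO : 1 ≤ P.H d * P.opt) :
    (P.T n d : ℝ) ≤ 25 * (P.H d * P.opt) * Real.log n / P.α ^ 2 := by
  have hα := hP.α_mem.1
  have hα1 := hP.α_mem.2
  have hlog := half_le_log_natCast hn
  have hx : 1 / 2 ≤ P.H d * P.opt * Real.log n / P.α ^ 2 := by
    rw [le_div_iff₀ (by positivity)]
    nlinarith
  have e : 20 * P.H d * P.opt * Real.log n / P.α ^ 2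
      = 20 * (P.H d * P.opt * Real.log n / P.α ^ 2) := by ring
  have h1 := (Nat.ceil_lt_add_one (a := 20 * P.H d * P.opt * Real.log n / P.α ^ 2)
    (by rw [e]; linarith)).le
  have e2 : 25 * (P.H d * P.opt) * Real.log n / P.α ^ 2
      = 25 * (P.H d * P.opt * Real.log n / P.α ^ 2) := by ring
  rw [e2]
  rw [T]
  linarith

lemma rpow_three_halves {x : ℝ} (hx : 0 < x) : x ^ (1.5 : ℝ) = x * Real.sqrt x := by
  rw [Real.sqrt_eq_rpow, show (1.5 : ℝ) = 1 + 1 / 2 by norm_num, Real.rpow_add hx, Real.rpow_one]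

lemma Valid.s_le [NeZero d] (hP : P.Valid) (hn : 2 ≤ n) (hHO : 1 ≤ P.H d * P.opt) {L : ℝ}
    (hL : Real.log d + Real.log (P.T n d / P.β) ≤ L) :
    P.s n d ≤ 1200 * ((P.H d * P.opt) ^ (1.5 : ℝ) * L
      * Real.sqrt (Real.log n * Real.log (1 / P.δ)) / (P.α ^ 2 * P.ε)) := by
  have hα := hP.α_mem.1
  have hε := hP.ε_pos
  have hl := hP.log_inv_δ_pos
  have hlog := log_natCast_pos hn
  have hT := hP.T_pos hn (d := d) (pos_of_mul_pos_left (by linarith) hP.opt_pos.le)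
  have hT' : (0 : ℝ) < P.T n d := by exact_mod_cast hT
  have hT25 := hP.T_le hn hHO
  have hL0 := hP.log_d_add_log_pos hT
  set l := Real.log (1 / P.δ)
  have hHO0 : 0 < P.H d * P.opt := by linarith
  rw [rpow_three_halves hHO0]
  set h := P.H d * P.opt with hh
  set q := Real.sqrt (Real.log n * l) with hq
  have hsq : Real.sqrt (P.T n d * l) ≤ 5 * Real.sqrt h * q / P.α := by
    rw [Real.sqrt_le_left (by positivity), div_pow, mul_pow, mul_pow, Real.sq_sqrt hHO0.le, hq,
      Real.sq_sqrt (by positivity)]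
    calc P.T n d * l ≤ 25 * h * Real.log n / P.α ^ 2 * l := by gcongr
      _ = 5 ^ 2 * h * (Real.log n * l) / P.α ^ 2 := by ring
  have hsqpos : 0 < Real.sqrt (P.T n d * l) := by positivity
  have e : P.s n d = 240 * h * (Real.log d + Real.log (P.T n d / P.β))
      * Real.sqrt (P.T n d * l) / (P.α * P.ε) := by
    rw [s, ε', hh]
    field_simp
    ring
  rw [e]
  calc 240 * h * (Real.log d + Real.log (P.T n d / P.β)) * Real.sqrt (P.T n d * l) / (P.α * P.ε)
      ≤ 240 * h * L * (5 * Real.sqrt h * q / P.α) / (P.α * P.ε) := by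
        have : 0 ≤ L := hL0.le.trans hL
        gcongr
    _ = 1200 * (h * Real.sqrt h * L * q / (P.α ^ 2 * P.ε)) := by
        field_simp
        ring

/-- The logarithm of `n / (α β)` splits. -/
lemma Valid.log_div_eq (hP : P.Valid) (hn : 2 ≤ n) :
    Real.log (n / (P.α * P.β)) = Real.log n + -Real.log P.α + -Real.log P.β := by
  have hn' : (n : ℝ) ≠ 0 := by positivity
  rw [Real.log_div hn' (mul_pos hP.α_mem.1 hP.β_mem.1).ne',
    Real.log_mul hP.α_mem.1.ne' hP.β_mem.1.ne']
  ring

lemma Valid.log_α_nonpos (hP : P.Valid) : Real.log P.α ≤ 0 :=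
  Real.log_nonpos hP.α_mem.1.le hP.α_mem.2.le

lemma Valid.log_β_nonpos (hP : P.Valid) : Real.log P.β ≤ 0 :=
  Real.log_nonpos hP.β_mem.1.le hP.β_mem.2.le

lemma Valid.half_le_log_div (hP : P.Valid) (hn : 2 ≤ n) :
    1 / 2 ≤ Real.log (n / (P.α * P.β)) := by
  rw [hP.log_div_eq hn]
  linarith [half_le_log_natCast hn, hP.log_α_nonpos, hP.log_β_nonpos]

/-- `log (n/(αβ)) ≥ 1/2` absorbs the numerical constants, and `log log n ≤ log n - 1` the iterated
logarithm. -/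
lemma Valid.log_T_le (hP : P.Valid) (hn : 2 ≤ n) (hHO : 1 ≤ P.H d * P.opt) :
    Real.log (P.T n d / P.β)
      ≤ 10 * Real.log (n / (P.α * P.β)) + Real.log (P.H d * P.opt) := by
  have hα := hP.α_mem.1
  have hlog := log_natCast_pos hn
  have hT := hP.T_pos hn (d := d) (pos_of_mul_pos_left (by linarith) hP.opt_pos.le)
  have hT' : (0 : ℝ) < P.T n d := by exact_mod_cast hT
  have h1 := Real.log_le_log hT' (hP.T_le hn hHO)
  have hHO0 : 0 < P.H d * P.opt := by linarith
  rw [Real.log_div (by positivity) (by positivity), Real.log_mul (by positivity) hlog.ne',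
    Real.log_mul (by norm_num) hHO0.ne', Real.log_pow] at h1
  have h2 : Real.log (25 : ℝ) ≤ 4 := by
    have : Real.log (25 : ℝ) ≤ Real.log (2 ^ 5) := Real.log_le_log (by norm_num) (by norm_num)
    rw [Real.log_pow] at this
    have h3 := Real.log_two_lt_d9
    push_cast at this
    linarith
  have h3 := Real.log_le_sub_one_of_pos hlog
  rw [Real.log_div hT'.ne' hP.β_mem.1.ne']
  have h4 := hP.log_div_eq hn
  have h5 := hP.half_le_log_div hn
  push_cast at h1
  linarith [hP.log_α_nonpos, hP.log_β_nonpos]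

/-- For `d ≥ 2` the minimum of the sum and the product of the logarithms is comparable to the
sum. -/
lemma add_le_four_mul_min {a b : ℝ} (ha : 1 / 2 ≤ a) (hb : 1 / 2 ≤ b) :
    a + b ≤ 4 * min (a + b) (a * b) := by
  rw [mul_min_of_nonneg _ _ (by norm_num)]
  refine le_min (by linarith) ?_
  nlinarith

lemma le_maxEntry (A : Matrix (Fin n) (Fin d) ℝ) (i : Fin n) (j : Fin d) :
    A i j ≤ maxEntry A :=
  le_ciSup (f := fun p : Fin n × Fin d => A p.1 p.2) (Set.finite_range _).bddAbove (i, j)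

/-- With a single variable the output is the optimal solution. -/
lemma violatesAtMost_zero_of_d_eq_one [NeZero d] (hd : d = 1) (hP : P.Valid) (hn : 2 ≤ n)
    {A : Matrix (Fin n) (Fin d) ℝ} (hA : A ∈ P.inputs n d) (hopt : IsOptimalValue A P.opt) :
    P.ViolatesAtMost A 0 := by
  subst hd
  refine violatesAtMost_of_support hP fun x hx => ?_
  obtain ⟨y, hy, hys⟩ := hopt.1
  have hxs := (mem_support_algorithm hP hx).2.1 (hP.T_pos_of_isOptimalValue hn hA hopt)
  have hxy : x = y := by
    funext j
    rw [Subsingleton.elim j 0]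
    simp only [Fin.sum_univ_one] at hxs hys
    rw [hxs, hys]
  have : {i : Fin n | (A *ᵥ x) i < 1 - P.α} = ∅ := by
    rw [Set.eq_empty_iff_forall_notMem]
    intro i hi
    have h1 := hy.2 i
    rw [hxy] at hi
    have h2 : (A *ᵥ y) i < 1 - P.α := hi
    linarith [hP.α_mem.1]
  simp [numViolated, this]

/-- For `d = 1` the claimed bound degenerates to `0`, which forces the separate exact argument for a
single variable. -/
lemma Valid.min_log_eq_zero (hP : P.Valid) (hd : d = 1) (hn : 2 ≤ n) :
    min (Real.log d + Real.log (n / (P.α * P.β)))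
      (Real.log d * Real.log (n / (P.α * P.β))) = 0 := by
  have hb := hP.half_le_log_div hn
  rw [hd, Nat.cast_one, Real.log_one, zero_mul, zero_add]
  exact min_eq_right (by linarith)

/-- The bound of the theorem with pre-processing. -/
lemma violatesAtMost_of_clip [NeZero d] (hP : P.Valid) (hn : 2 ≤ n)
    {A : Matrix (Fin n) (Fin d) ℝ} (hA : A ∈ P.inputs n d) (hopt : IsOptimalValue A P.opt)
    (hc : P.clip = true) {C : ℝ} (hC : 1200 * 40 ^ (1.5 : ℝ) * (20 * 4) ≤ C) :
    P.ViolatesAtMost A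
      (C * ((d : ℝ) ^ (1.5 : ℝ)
        * min (Real.log d + Real.log (n / (P.α * P.β)))
            (Real.log d * Real.log (n / (P.α * P.β)))
        * Real.sqrt (Real.log n * Real.log (1 / P.δ)) / (P.α ^ (3.5 : ℝ) * P.ε))) := by
  have hd0 : 0 < d := Nat.pos_of_ne_zero (NeZero.ne d)
  have hb := hP.half_le_log_div hn
  rcases Nat.eq_or_lt_of_le hd0 with hd | hd
  · rw [hP.min_log_eq_zero hd.symm hn]
    simpa using violatesAtMost_zero_of_d_eq_one hd.symm hP hn hA hopt
  have hα := hP.α_mem.1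
  have hopt0 := hP.opt_pos
  have hε := hP.ε_pos
  have hd' : (0 : ℝ) < d := by exact_mod_cast hd0
  have ha := half_le_log_natCast (n := d) hd
  have hHO := one_le_H_mul_opt hP hn hA hopt
  set a := Real.log d
  set b := Real.log (n / (P.α * P.β)) with hbdef
  have hm := add_le_four_mul_min ha hb
  have hHeq : P.H d * P.opt = 40 * (d / P.α) := by rw [H, if_pos hc]; field_simp
  have hlogH : Real.log (P.H d * P.opt) ≤ 4 + a + b := by
    rw [hHeq, Real.log_mul (by norm_num) (by positivity), Real.log_div hd'.ne' hα.ne']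
    have h40 : Real.log (40 : ℝ) ≤ 4.2 := by
      have : Real.log (40 : ℝ) ≤ Real.log (2 ^ 6) := Real.log_le_log (by norm_num) (by norm_num)
      rw [Real.log_pow] at this
      have h3 := Real.log_two_lt_d9
      push_cast at this
      linarith
    have := hP.log_div_eq hn
    linarith [hP.log_β_nonpos, half_le_log_natCast hn]
  have hT := hP.log_T_le hn hHO
  -- The logarithms total at most `2a + 11b + 4 ≤ 20 (a + b)`, because `a + b ≥ 1`; the factor `4`
  -- passes to the minimum.
  have hs := hP.s_le hn hHO (L := 20 * 4 * min (a + b) (a * b)) (by linarith)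
  refine (violatesAtMost_s hP hn hA hopt).mono (hs.trans ?_)
  rw [hHeq, Real.mul_rpow (by norm_num) (by positivity), Real.div_rpow hd'.le hα.le,
    show (3.5 : ℝ) = 1.5 + 2 by norm_num, Real.rpow_add hα, Real.rpow_two]
  have hm0 : 0 ≤ min (a + b) (a * b) := by linarith
  calc _ = 1200 * 40 ^ (1.5 : ℝ) * (20 * 4) * ((d : ℝ) ^ (1.5 : ℝ) * min (a + b) (a * b)
        * Real.sqrt (Real.log n * Real.log (1 / P.δ)) / (P.α ^ (1.5 : ℝ) * P.α ^ 2 * P.ε)) := by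
        field_simp
    _ ≤ _ := by gcongr

/-- The bound of the theorem without pre-processing. -/
lemma violatesAtMost_of_not_clip [NeZero d] (hP : P.Valid) (hn : 2 ≤ n)
    {A : Matrix (Fin n) (Fin d) ℝ} (hA : A ∈ P.inputs n d) (hopt : IsOptimalValue A P.opt)
    (hc : P.clip = false) {K E C : ℝ} (hK : 1 ≤ K) (hE : 1 ≤ E) (hεE : P.ε ≤ E)
    (hR : P.R ≤ K * maxEntry A) (hC1 : 1200 * K ^ (1.5 : ℝ) * ((11 + 2 * K) * 4) ≤ C)
    (hC2 : 32 * E ≤ C) :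
    P.ViolatesAtMost A
      (C * ((maxEntry A * P.opt) ^ (1.5 : ℝ)
        * min (Real.log d + Real.log (n / (P.α * P.β)))
            (Real.log d * Real.log (n / (P.α * P.β)))
        * Real.sqrt (Real.log n * Real.log (1 / P.δ)) / (P.α ^ 2 * P.ε))) := by
  have hd0 : 0 < d := Nat.pos_of_ne_zero (NeZero.ne d)
  have hb := hP.half_le_log_div hn
  rcases Nat.eq_or_lt_of_le hd0 with hd | hd
  · rw [hP.min_log_eq_zero hd.symm hn]
    simpa using violatesAtMost_zero_of_d_eq_one hd.symm hP hn hA hopt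
  have hα := hP.α_mem.1
  have hα1 := hP.α_mem.2
  have hopt0 := hP.opt_pos
  have hε := hP.ε_pos
  have hl := hP.log_inv_δ_pos
  have ha := half_le_log_natCast (n := d) hd
  have hlogn := half_le_log_natCast hn
  have hHO := one_le_H_mul_opt hP hn hA hopt
  have hMO := one_le_mul_opt hn hopt (le_maxEntry A)
  set a := Real.log d
  set b := Real.log (n / (P.α * P.β)) with hbdef
  set W := maxEntry A * P.opt with hW
  set q := Real.sqrt (Real.log n * Real.log (1 / P.δ)) with hq
  have hm := add_le_four_mul_min ha hb
  -- `L` does not control `log W` for large `W`. If `W ≥ n`, the claimed bound is at least `n` and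
  -- nothing is to prove; otherwise `log W ≤ log n ≤ b`.
  rcases le_or_gt (n : ℝ) W with hnW | hnW
  · refine violatesAtMost_of_support hP fun x _ => ?_
    have hviol : (numViolated A P.α x : ℝ) ≤ n := by exact_mod_cast numViolated_le A P.α x
    refine hviol.trans (hnW.trans ?_)
    -- The factor `1/ε` in the bound is offset by `q`, as `log (1/δ) ≥ ε/4`; only here does the
    -- upper bound `E` on `ε` enter.
    have hqge : P.ε / (8 * E) ≤ q := by
      rw [hq]
      refine Real.le_sqrt_of_sq_le ?_
      have h2 : 1 ≤ Real.sqrt 2 := Real.one_le_sqrt.2 (by norm_num)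
      have h3 : P.ε / 4 ≤ Real.log (1 / P.δ) := by nlinarith [hP.ε_le]
      have h4 : P.ε / (8 * E) ≤ 1 / 8 := by
        rw [div_le_div_iff₀ (by positivity) (by norm_num)]; linarith
      have h5 : P.ε / (8 * E) ≤ P.ε := div_le_self hε.le (by linarith)
      have h6 : 0 ≤ P.ε / (8 * E) := by positivity
      nlinarith
    have hWp : W ≤ W ^ (1.5 : ℝ) := by
      nth_rewrite 1 [← Real.rpow_one W]
      exact Real.rpow_le_rpow_of_exponent_le hMO (by norm_num)
    have hden : P.α ^ 2 * P.ε ≤ P.ε :=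
      mul_le_of_le_one_left hε.le (pow_le_one₀ hα.le hα1.le)
    have hC0 : 0 ≤ C := by linarith
    have hmin : 1 / 4 ≤ min (a + b) (a * b) := by linarith
    calc W = 32 * E * (W * (1 / 4) * (P.ε / (8 * E)) / P.ε) := by field_simp; norm_num
      _ ≤ C * (W ^ (1.5 : ℝ) * min (a + b) (a * b) * q / (P.α ^ 2 * P.ε)) := by gcongr
  · have hHW : P.H d * P.opt ≤ K * W := by
      have : P.H d = P.R := by simp [H, hc]
      rw [this, hW, ← mul_assoc]
      exact mul_le_mul_of_nonneg_right hR hopt0.le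
    have hW0 : 0 < W := by linarith
    have hlogH : Real.log (P.H d * P.opt) ≤ K + b := by
      have h1 := Real.log_le_log (by linarith) hHW
      rw [Real.log_mul (by positivity) hW0.ne'] at h1
      have h2 := Real.log_le_log hW0 hnW.le
      have h3 := Real.log_le_sub_one_of_pos (show 0 < K by linarith)
      have := hP.log_div_eq hn
      linarith [hP.log_β_nonpos, hP.log_α_nonpos]
    have hT := hP.log_T_le hn hHO
    have hs := hP.s_le hn hHO (L := (11 + 2 * K) * (4 * min (a + b) (a * b))) (by
      have := mul_le_mul_of_nonneg_left hm (show 0 ≤ 11 + 2 * K by positivity)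
      nlinarith)
    refine (violatesAtMost_s hP hn hA hopt).mono (hs.trans ?_)
    have hm0 : 0 ≤ min (a + b) (a * b) := by linarith
    have hpw : (P.H d * P.opt) ^ (1.5 : ℝ) ≤ K ^ (1.5 : ℝ) * W ^ (1.5 : ℝ) := by
      rw [← Real.mul_rpow (by positivity) hW0.le]
      exact Real.rpow_le_rpow (by linarith) hHW (by norm_num)
    calc _ ≤ 1200 * (K ^ (1.5 : ℝ) * W ^ (1.5 : ℝ) * ((11 + 2 * K) * (4 * min (a + b) (a * b)))
          * q / (P.α ^ 2 * P.ε)) := by gcongr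
      _ = 1200 * K ^ (1.5 : ℝ) * ((11 + 2 * K) * 4) * (W ^ (1.5 : ℝ) * min (a + b) (a * b)
          * q / (P.α ^ 2 * P.ε)) := by ring
      _ ≤ _ := by gcongr

end Bounds

end Params

end PrivateCovering

theorem theorem4 :
    -- privacy
    (∀ (n d : ℕ) [NeZero d] (P : PrivateCovering.Params), 2 ≤ n → P.Valid →
      PrivateCovering.IsDP (P.inputs n d) PrivateCovering.Neighbors
        (fun A => P.algorithm A) P.ε P.δ) ∧
    -- objective value
    (∀ (n d : ℕ) [NeZero d] (P : PrivateCovering.Params), 2 ≤ n → P.Valid →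
      ∀ A ∈ P.inputs n d, PrivateCovering.IsOptimalValue A P.opt →
        ∀ x ∈ (P.algorithm A).support, (∀ j, 0 ≤ x j) ∧ ∑ j, x j ≤ (1 + P.α) * P.opt) ∧
    -- number of violated constraints
    (∀ K E : ℝ, ∃ C : ℝ, 0 < C ∧
      ∀ (n d : ℕ) [NeZero d] (P : PrivateCovering.Params), 2 ≤ n → P.Valid → P.ε ≤ E →
      ∀ A ∈ P.inputs n d, PrivateCovering.IsOptimalValue A P.opt →
        (P.clip = false → P.R ≤ K * PrivateCovering.maxEntry A →
          P.ViolatesAtMost A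
            (C * ((PrivateCovering.maxEntry A * P.opt) ^ (1.5 : ℝ)
              * min (Real.log d + Real.log (n / (P.α * P.β)))
                  (Real.log d * Real.log (n / (P.α * P.β)))
              * Real.sqrt (Real.log n * Real.log (1 / P.δ)) / (P.α ^ 2 * P.ε)))) ∧
        (P.clip = true →
          P.ViolatesAtMost A
            (C * ((d : ℝ) ^ (1.5 : ℝ)
              * min (Real.log d + Real.log (n / (P.α * P.β)))
                  (Real.log d * Real.log (n / (P.α * P.β)))
              * Real.sqrt (Real.log n * Real.log (1 / P.δ)) / (P.α ^ (3.5 : ℝ) * P.ε))))) := by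
  refine ⟨fun n d _ P _ hP => P.isDP_algorithm hP, ?_, ?_⟩
  · intro n d _ P _ hP A _ _ x hx
    obtain ⟨h0, -, h1⟩ := PrivateCovering.Params.mem_support_algorithm hP hx
    exact ⟨h0, h1.trans (le_mul_of_one_le_left hP.opt_pos.le (by linarith [hP.α_mem.1]))⟩
  · intro K E
    have hK1 : 1 ≤ max K 1 := le_max_right _ _
    have hE1 : 1 ≤ max E 1 := le_max_right _ _
    have hc1 : 0 < 1200 * (40 : ℝ) ^ (1.5 : ℝ) * (20 * 4) := by positivity
    have hc2 : 0 < 1200 * max K 1 ^ (1.5 : ℝ) * ((11 + 2 * max K 1) * 4) := by positivity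
    have hc3 : 0 < 32 * max E 1 := by positivity
    -- The sum of the three positive constants dominates each of them. `K` and `E` are arbitrary
    -- reals, hence the maxima with `1`.
    refine ⟨1200 * (40 : ℝ) ^ (1.5 : ℝ) * (20 * 4)
      + 1200 * max K 1 ^ (1.5 : ℝ) * ((11 + 2 * max K 1) * 4) + 32 * max E 1,
      by linarith, ?_⟩
    intro n d _ P hn hP hE A hA hopt
    refine ⟨fun hc hR => ?_, fun hc => ?_⟩
    · have hmax : 0 ≤ PrivateCovering.maxEntry A := by
        have := PrivateCovering.Params.one_le_mul_opt hn hopt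
          (PrivateCovering.Params.le_maxEntry A)
        exact (pos_of_mul_pos_left (by linarith) hP.opt_pos.le).le
      exact PrivateCovering.Params.violatesAtMost_of_not_clip hP hn hA hopt hc hK1 hE1
        (hE.trans (le_max_left _ _))
        (hR.trans (mul_le_mul_of_nonneg_right (le_max_left _ _) hmax))
        (by linarith) (by linarith)
    · exact PrivateCovering.Params.violatesAtMost_of_clip hP hn hA hopt hc (by linarith)
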